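/- Let $n\ge 1$ and let $F:\mathbb R^n\to[0,\infty)$ be a Minkowski norm, i.e. $F$ is continuous, $C^\infty$ on $\mathbb R^n\setminus\{0\}$, satisfies $F(tv)=tF(v)$ for all $t\ge 0$ and $v\in\mathbb R^n$, and the Hessian of $\frac12F^2$ is positive definite at every $v\neq 0$ ($F$ need not be even). For $x,y\in\mathbb R^n$ let $d_F(x,y)$ be the infimum of $\int_0^r F(\dot\sigma(t))\,dt$ over all piecewise $C^\infty$ curves $\sigma:[0,r]\to\mathbb R^n$, $r>0$, with $\sigma(0)=x$ and $\sigma(r)=y$. Put $B^+(x,r)=\{z: d_F(x,z)<r\}$ and $B^-(x,r)=\{z: d_F(z,x)<r\}$. For $s\in(0,1)$ let $Z_s(A,B)$ be the set of all $z\in\mathbb R^n$ for which there are $x\in A$ and $y\in B$ with $d_F(x,z)=s\,d_F(x,y)$ and $d_F(z,y)=(1-s)\,d_F(x,y)$. Let $\mathsf m_F$ be the canonical measure of the Minkowski space $(\mathbb R^n,F)$, in either of its two usual normalizations: the Lebesgue measure $\mathcal L^n$, or the Busemann–Hausdorff measure $\frac{\omega_n}{\mathcal L^n(\{F<1\})}\mathcal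 L^n$, where $\omega_n$ is the volume of the Euclidean unit ball (the measure of $Z_s(A,B)$ is understood as outer measure). Fix $s\in(0,1)$. For all nonempty open bounded sets $A,B\subset\mathbb R^n$, $$\mathsf m_F(Z_s(A,B))^{1/n}\ \ge\ (1-s)\,\mathsf m_F(A)^{1/n}+s\,\mathsf m_F(B)^{1/n};\qquad (*)$$ moreover, if $A$ and $B$ are convex, then equality holds in $(*)$ if and only if $A$ and $B$ are homothetic, i.e. $B=cA+x_0$ for some $c>0$ and $x_0\in\mathbb R^n$. For all $x,y\in\mathbb R^n$ and $r,R>0$ the following are equivalent: (i) equality holds in $(*)$ for $A=B^+(x,r)$ and $B=B^-(y,R)$; (ii) $B^-(y-x_0,R)=B^+\left(\frac Rr x,R\right)$ for some $x_0\in\mathbb R^n$. -/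

import Mathlib

open MeasureTheory
open scoped ContDiff ENNReal

noncomputable section

/-- The fundamental tensor `g_v(w₁, w₂) = D²(F²/2)(v)[w₁, w₂]` of a function `F` on `ℝⁿ`. -/
def fundamentalTensor {n : ℕ} (F : EuclideanSpace ℝ (Fin n) → ℝ)
    (v w₁ w₂ : EuclideanSpace ℝ (Fin n)) : ℝ :=
  iteratedFDeriv ℝ 2 (fun u => F u ^ 2 / 2) v ![w₁, w₂]

/-- Minkowski norms on `ℝⁿ` (not necessarily reversible); `(ℝⁿ, F)` is then a Minkowski space. -/
structure IsMinkowskiNorm {n : ℕ} (F : EuclideanSpace ℝ (Fin n) → ℝ) : Prop where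
  nonneg : ∀ v, 0 ≤ F v
  continuous : Continuous F
  smooth : ContDiffOn ℝ ∞ F {0}ᶜ
  homogeneous : ∀ (t : ℝ) (v), 0 ≤ t → F (t • v) = t * F v
  posDef : ∀ v, v ≠ 0 → ∀ w, w ≠ 0 → 0 < fundamentalTensor F v w w

/-- `σ : [0, r] → ℝⁿ` is piecewise `C^∞`: there is a finite partition
`0 = τ 0 < τ 1 < ⋯ < τ k = r` such that `σ` is `C^∞` on each closed piece. -/
def IsPiecewiseSmooth {n : ℕ} (σ : ℝ → EuclideanSpace ℝ (Fin n)) (r : ℝ) : Prop :=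
  ContinuousOn σ (Set.Icc 0 r) ∧
    ∃ (k : ℕ) (τ : ℕ → ℝ), τ 0 = 0 ∧ τ k = r ∧
      ∀ i < k, τ i < τ (i + 1) ∧ ContDiffOn ℝ ∞ σ (Set.Icc (τ i) (τ (i + 1)))

/-- The integral length of `σ : [0, r] → ℝⁿ` for the translation invariant Finsler metric
`(x, v) ↦ F v`. -/
def finslerLength {n : ℕ} (F : EuclideanSpace ℝ (Fin n) → ℝ)
    (σ : ℝ → EuclideanSpace ℝ (Fin n)) (r : ℝ) : ℝ :=
  ∫ t in (0 : ℝ)..r, F (deriv σ t)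

/-- The (in general non-symmetric) metric function `d_F(x, y)`: the infimum of the lengths of the
piecewise smooth curves from `x` to `y`. -/
def finslerDist {n : ℕ} (F : EuclideanSpace ℝ (Fin n) → ℝ)
    (x y : EuclideanSpace ℝ (Fin n)) : ℝ :=
  sInf {L : ℝ | ∃ (r : ℝ) (σ : ℝ → EuclideanSpace ℝ (Fin n)), 0 < r ∧ IsPiecewiseSmooth σ r ∧
    σ 0 = x ∧ σ r = y ∧ L = finslerLength F σ r}

/-- The forward ball `B⁺(x, r)`. -/
def forwardBall {n : ℕ} (F : EuclideanSpace ℝ (Fin n) → ℝ)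
    (x : EuclideanSpace ℝ (Fin n)) (r : ℝ) : Set (EuclideanSpace ℝ (Fin n)) :=
  {y | finslerDist F x y < r}

/-- The backward ball `B⁻(x, r)`. -/
def backwardBall {n : ℕ} (F : EuclideanSpace ℝ (Fin n) → ℝ)
    (x : EuclideanSpace ℝ (Fin n)) (r : ℝ) : Set (EuclideanSpace ℝ (Fin n)) :=
  {y | finslerDist F y x < r}

/-- The set `Z_s(x, y)` of `s`-intermediate points from `x` to `y`. -/
def intermediatePoints {n : ℕ} (F : EuclideanSpace ℝ (Fin n) → ℝ) (s : ℝ)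
    (x y : EuclideanSpace ℝ (Fin n)) : Set (EuclideanSpace ℝ (Fin n)) :=
  {z | finslerDist F x z = s * finslerDist F x y ∧
    finslerDist F z y = (1 - s) * finslerDist F x y}

/-- The Minkowski interpolation set `Z_s(A, B) = ⋃_{x ∈ A, y ∈ B} Z_s(x, y)`. -/
def interpolationSet {n : ℕ} (F : EuclideanSpace ℝ (Fin n) → ℝ) (s : ℝ)
    (A B : Set (EuclideanSpace ℝ (Fin n))) : Set (EuclideanSpace ℝ (Fin n)) :=
  ⋃ x ∈ A, ⋃ y ∈ B, intermediatePoints F s x y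

/-- The Busemann–Hausdorff measure of `(ℝⁿ, F)`: the measure with (constant) density
`ω_n / ℒⁿ({v | F v < 1})` with respect to Lebesgue measure, where `ω_n` is the volume of the
Euclidean unit ball. -/
def busemannHausdorffMeasure {n : ℕ} (F : EuclideanSpace ℝ (Fin n) → ℝ) :
    Measure (EuclideanSpace ℝ (Fin n)) :=
  volume.withDensity fun _ =>
    volume (Metric.ball (0 : EuclideanSpace ℝ (Fin n)) 1) /
      volume {v : EuclideanSpace ℝ (Fin n) | F v < 1}

/-- `m` is the canonical measure of the Minkowski space `(ℝⁿ, F)`, in either of its two customary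
normalizations: Lebesgue measure, or the Busemann–Hausdorff measure (a constant multiple of it). -/
def IsFinslerMeasure {n : ℕ} (F : EuclideanSpace ℝ (Fin n) → ℝ)
    (m : Measure (EuclideanSpace ℝ (Fin n))) : Prop :=
  m = volume ∨ m = busemannHausdorffMeasure F

/-- The left-hand side `m(Z_s(A, B))^{1/n}` of the Brunn–Minkowski inequality. In Mathlib the value
of a measure at a set that is not measurable is its outer measure. -/
def bmLeft {n : ℕ} (F : EuclideanSpace ℝ (Fin n) → ℝ) (m : Measure (EuclideanSpace ℝ (Fin n)))
    (s : ℝ) (A B : Set (EuclideanSpace ℝ (Fin n))) : ℝ≥0∞ :=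
  m (interpolationSet F s A B) ^ (1 / (n : ℝ))

/-- The right-hand side `(1 - s) m(A)^{1/n} + s m(B)^{1/n}` of the Brunn–Minkowski inequality. -/
def bmRight {n : ℕ} (m : Measure (EuclideanSpace ℝ (Fin n)))
    (s : ℝ) (A B : Set (EuclideanSpace ℝ (Fin n))) : ℝ≥0∞ :=
  ENNReal.ofReal (1 - s) * m A ^ (1 / (n : ℝ)) + ENNReal.ofReal s * m B ^ (1 / (n : ℝ))

/-- `A` and `B` are (positively) homothetic: `B = c A + x₀` for some `c > 0` and `x₀ ∈ ℝⁿ`. -/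
def AreHomothetic {n : ℕ} (A B : Set (EuclideanSpace ℝ (Fin n))) : Prop :=
  ∃ (c : ℝ) (x₀ : EuclideanSpace ℝ (Fin n)), 0 < c ∧ B = (fun a => c • a + x₀) '' A

end

/-! A Minkowski norm is translation invariant, so Jensen's inequality shows that straight segments
minimize length and `finslerDist F x y = F (y - x)`. Positive definiteness of the Hessian gives the
strict triangle inequality, so the only `s`-intermediate point from `x` to `y` is `(1 - s) • x + s •
y`. Hence `interpolationSet F s A B` is the Minkowski sum `(1 - s) • A + s • B`, both choices of `m`
are Haar measures, and the claim is the classical Brunn–Minkowski theorem.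

The inequality (`brunnMinkowski`) is proved in its dimension-free multiplicative form by induction
on the dimension: the one-dimensional Prékopa–Leindler inequality is applied to the volumes of
slices. Rescaling both sets to volume one then gives the additive form.

For equality (`brunnMinkowski_eq_iff`), again normalize to volume one. For each functional `f`,
Brunn–Minkowski applied to the parts of `A` and `B` on either side of level hyperplanes forces their
volume profiles along `f` to agree up to a shift (`exists_lowerVolume_eq`). The shift is `f` of the
difference of barycenters, so a single vector serves all `f`, and Hahn–Banach separation shows that
this vector translates `A` onto `B`.

For balls, homothety has ratio `R / r` by volume comparison, which turns it into condition (ii). -/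

set_option linter.unusedSectionVars false

/-! ### Convexity and positivity of Minkowski norms. -/

namespace IsMinkowskiNorm

variable {n : ℕ} {F : EuclideanSpace ℝ (Fin n) → ℝ}

theorem map_zero (hF : IsMinkowskiNorm F) : F 0 = 0 := by
  simpa using hF.homogeneous 0 0 le_rfl

theorem contDiffAt_sq (hF : IsMinkowskiNorm F) {v : EuclideanSpace ℝ (Fin n)} (hv : v ≠ 0) :
    ContDiffAt ℝ ∞ (fun u => F u ^ 2 / 2) v := by
  have h : ContDiffAt ℝ ∞ F v := hF.smooth.contDiffAt (isOpen_compl_singleton.mem_nhds hv)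
  exact (h.pow 2).div_const 2

/-- The energy `F² / 2` is strictly convex along segments avoiding the origin. -/
theorem strictConvexOn_line (hF : IsMinkowskiNorm F) {v w : EuclideanSpace ℝ (Fin n)}
    (hw : w ≠ 0) (h0 : ∀ t ∈ Set.Icc (0 : ℝ) 1, v + t • w ≠ 0) :
    StrictConvexOn ℝ (Set.Icc (0 : ℝ) 1) (fun t => F (v + t • w) ^ 2 / 2) := by
  set G : EuclideanSpace ℝ (Fin n) → ℝ := fun u => F u ^ 2 / 2 with hG
  have hline : ∀ t : ℝ, HasDerivAt (fun t : ℝ => v + t • w) w t := fun t => by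
    simpa using ((hasDerivAt_id t).smul_const w).const_add v
  have hd1 : ∀ t : ℝ, v + t • w ≠ 0 →
      HasDerivAt (fun t : ℝ => G (v + t • w)) (fderiv ℝ G (v + t • w) w) t := fun t ht =>
    ((hF.contDiffAt_sq ht).differentiableAt (by simp)).hasFDerivAt.comp_hasDerivAt (f := fun t : ℝ => v + t • w) t (hline t)
  have hd2 : ∀ t : ℝ, v + t • w ≠ 0 →
      HasDerivAt (fun t : ℝ => fderiv ℝ G (v + t • w) w)
        (fderiv ℝ (fderiv ℝ G) (v + t • w) w w) t := fun t ht => by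
    have h1 : DifferentiableAt ℝ (fderiv ℝ G) (v + t • w) :=
      ((hF.contDiffAt_sq ht).fderiv_right (m := 1) (by norm_cast)).differentiableAt (by simp)
    have h2 := h1.hasFDerivAt.comp_hasDerivAt (f := fun t : ℝ => v + t • w) t (hline t)
    simpa using h2.clm_apply (hasDerivAt_const t w)
  refine strictConvexOn_of_deriv2_pos (convex_Icc 0 1) ?_ fun t ht => ?_
  · have : Continuous fun t : ℝ => F (v + t • w) ^ 2 / 2 := by
      have := hF.continuous
      fun_prop
    exact this.continuousOn
  · rw [interior_Icc] at ht
    have ht0 := h0 t (Set.Ioo_subset_Icc_self ht)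
    have hev : deriv (fun t : ℝ => G (v + t • w)) =ᶠ[nhds t]
        fun t : ℝ => fderiv ℝ G (v + t • w) w := by
      filter_upwards [isOpen_Ioo.mem_nhds ht] with u hu
      exact (hd1 u (h0 u (Set.Ioo_subset_Icc_self hu))).deriv
    have : deriv^[2] (fun t : ℝ => G (v + t • w)) t = fderiv ℝ (fderiv ℝ G) (v + t • w) w w := by
      simp only [Function.iterate_succ, Function.iterate_zero, Function.comp_apply, id]
      rw [hev.deriv_eq]
      exact (hd2 t ht0).deriv
    rw [this]
    have := hF.posDef _ ht0 w hw
    rwa [fundamentalTensor, iteratedFDeriv_two_apply] at this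

/-- If `F v = 0`, then `F² / 2` vanishes on the whole segment from `v` to `2v`, against its strict
convexity there. -/
theorem pos (hF : IsMinkowskiNorm F) {v : EuclideanSpace ℝ (Fin n)} (hv : v ≠ 0) : 0 < F v := by
  refine (hF.nonneg v).lt_of_ne' fun h => ?_
  have h0 : ∀ t ∈ Set.Icc (0 : ℝ) 1, v + t • v ≠ 0 := fun t ht h => by
    have : (1 + t) • v = 0 := by rw [add_smul, one_smul, h]
    rcases smul_eq_zero.1 this with h | h
    · linarith [ht.1]
    · exact hv h
  have hz : ∀ t ∈ Set.Icc (0 : ℝ) 1, F (v + t • v) = 0 := fun t ht => by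
    have : v + t • v = (1 + t) • v := by rw [add_smul, one_smul]
    rw [this, hF.homogeneous _ _ (by linarith [ht.1]), h, mul_zero]
  have := (hF.strictConvexOn_line hv h0).2 (show (0 : ℝ) ∈ Set.Icc 0 1 by simp)
    (show (1 : ℝ) ∈ Set.Icc 0 1 by simp) (by norm_num) (show (0 : ℝ) < 1 / 2 by norm_num)
    (show (0 : ℝ) < 1 / 2 by norm_num) (by norm_num)
  simp only [smul_eq_mul] at this
  rw [hz _ (by norm_num), hz 0 (by simp), hz 1 (by simp)] at this
  norm_num at this

theorem eq_zero_iff (hF : IsMinkowskiNorm F) {v : EuclideanSpace ℝ (Fin n)} :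
    F v = 0 ↔ v = 0 :=
  ⟨fun h => by_contra fun hv => (hF.pos hv).ne' h, fun h => h ▸ hF.map_zero⟩

/-- The unit ball of a Minkowski norm is strictly convex. -/
theorem lt_one_of_mem_segment (hF : IsMinkowskiNorm F) {v w : EuclideanSpace ℝ (Fin n)}
    (hv : F v = 1) (hw : F w = 1) (hvw : v ≠ w) {t : ℝ} (ht0 : 0 < t) (ht1 : t < 1) :
    F ((1 - t) • v + t • w) < 1 := by
  have hv0 : v ≠ 0 := fun h => by simp [h, hF.map_zero] at hv
  have hw0 : w ≠ 0 := fun h => by simp [h, hF.map_zero] at hw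
  by_cases h0 : ∀ t ∈ Set.Icc (0 : ℝ) 1, v + t • (w - v) ≠ 0
  · have := (hF.strictConvexOn_line (sub_ne_zero.2 hvw.symm) h0).2
      (show (0 : ℝ) ∈ Set.Icc 0 1 by simp) (show (1 : ℝ) ∈ Set.Icc 0 1 by simp) (by norm_num)
      (show 0 < 1 - t by linarith) ht0 (by ring)
    simp only [smul_eq_mul, mul_zero, zero_add, mul_one, zero_smul, add_zero, one_smul,
      add_sub_cancel, hv, hw] at this
    have he : (1 - t) • v + t • w = v + t • (w - v) := by module
    rw [he]
    have h1 := hF.nonneg (v + t • (w - v))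
    nlinarith
  -- The segment crosses the origin at parameter `u`, where no Hessian is available. Then `v` and
  -- `w` lie on opposite rays, and the point is a multiple of `v` or of `w` with factor in `[0, 1)`.
  · push Not at h0
    obtain ⟨u, hu, h⟩ := h0
    have hu0 : u ≠ 0 := fun h' => by simp [h'] at h; exact hv0 h
    have hu1 : u ≠ 1 := fun h' => by simp [h'] at h; exact hw0 h
    have hu0' : 0 < u := hu.1.lt_of_ne' hu0
    have hu1' : 0 < 1 - u := by have := hu.2.lt_of_ne hu1; linarith
    rcases le_total t u with htu | htu
    · have he : (1 - t) • v + t • w = ((u - t) / u) • v := by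
        have h2 : (t / u) • (v + u • (w - v)) = 0 := by rw [h, smul_zero]
        have h3 : (1 - t) • v + t • w = ((u - t) / u) • v + (t / u) • (v + u • (w - v)) := by
          match_scalars
          · field_simp
            ring
          · field_simp
        rw [h3, h2, add_zero]
      rw [he, hF.homogeneous _ _ (by apply div_nonneg <;> linarith), hv, mul_one,
        div_lt_one hu0']
      linarith
    · have he : (1 - t) • v + t • w = ((t - u) / (1 - u)) • w := by
        have h2 : ((1 - t) / (1 - u)) • (v + u • (w - v)) = 0 := by rw [h, smul_zero]
        have h3 : (1 - t) • v + t • w =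
            ((t - u) / (1 - u)) • w + ((1 - t) / (1 - u)) • (v + u • (w - v)) := by
          match_scalars <;> field_simp <;> ring
        rw [h3, h2, add_zero]
      rw [he, hF.homogeneous _ _ (by apply div_nonneg <;> linarith), hw, mul_one,
        div_lt_one hu1']
      linarith

theorem map_inv_smul_self (hF : IsMinkowskiNorm F) {v : EuclideanSpace ℝ (Fin n)} (hv : v ≠ 0) :
    F ((F v)⁻¹ • v) = 1 := by
  rw [hF.homogeneous _ _ (inv_nonneg.2 (hF.nonneg v)), inv_mul_cancel₀ (hF.pos hv).ne']

/-- The strict triangle inequality of a Minkowski norm. -/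
theorem add_lt (hF : IsMinkowskiNorm F) {v w : EuclideanSpace ℝ (Fin n)} (hv : v ≠ 0) (hw : w ≠ 0)
    (h : (F v)⁻¹ • v ≠ (F w)⁻¹ • w) : F (v + w) < F v + F w := by
  have hv' := hF.pos hv
  have hw' := hF.pos hw
  -- Up to the factor `F v + F w`, the sum `v + w` is the convex combination of the two normalized
  -- vectors with this weight.
  have h1 := hF.lt_one_of_mem_segment (hF.map_inv_smul_self hv) (hF.map_inv_smul_self hw) h
    (t := F w / (F v + F w)) (by positivity) (by rw [div_lt_one (by positivity)]; linarith)
  have he : v + w = (F v + F w) • ((1 - F w / (F v + F w)) • (F v)⁻¹ • v +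
      (F w / (F v + F w)) • (F w)⁻¹ • w) := by
    match_scalars <;> field_simp
    ring
  rw [he, hF.homogeneous _ _ (by positivity)]
  nlinarith

theorem add_le (hF : IsMinkowskiNorm F) (v w : EuclideanSpace ℝ (Fin n)) :
    F (v + w) ≤ F v + F w := by
  rcases eq_or_ne v 0 with rfl | hv
  · simp [hF.map_zero]
  rcases eq_or_ne w 0 with rfl | hw
  · simp [hF.map_zero]
  by_cases h : (F v)⁻¹ • v = (F w)⁻¹ • w
  · have hv' := hF.pos hv
    have hw' := hF.pos hw
    have h1 : w = (F w / F v) • v := by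
      have : F w • (F v)⁻¹ • v = F w • (F w)⁻¹ • w := by rw [h]
      rw [smul_inv_smul₀ hw'.ne', smul_smul] at this
      rw [div_eq_mul_inv, this]
    have h2 : v + w = (1 + F w / F v) • v := by rw [add_smul, one_smul, ← h1]
    rw [h2, hF.homogeneous _ _ (by positivity)]
    apply le_of_eq
    field_simp
  · exact (hF.add_lt hv hw h).le

theorem convexOn (hF : IsMinkowskiNorm F) : ConvexOn ℝ Set.univ F :=
  ⟨convex_univ, fun v _ w _ a b ha hb _ => by
    simpa [hF.homogeneous _ _ ha, hF.homogeneous _ _ hb] using hF.add_le (a • v) (b • w)⟩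

theorem exists_mul_norm_le (hF : IsMinkowskiNorm F) : ∃ c > 0, ∀ v, c * ‖v‖ ≤ F v := by
  -- The unit sphere is empty when `n = 0`; otherwise `c` is the minimum of `F` on it.
  rcases (Metric.sphere (0 : EuclideanSpace ℝ (Fin n)) 1).eq_empty_or_nonempty with h | h
  · refine ⟨1, one_pos, fun v => ?_⟩
    rcases eq_or_ne v 0 with rfl | hv
    · simp [hF.map_zero]
    · have : (‖v‖⁻¹ • v) ∈ Metric.sphere (0 : EuclideanSpace ℝ (Fin n)) 1 := by
        simp [norm_smul, hv]
      simp [h] at this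
  · obtain ⟨u, hu, hmin⟩ := (isCompact_sphere (0 : EuclideanSpace ℝ (Fin n)) 1).exists_isMinOn h
      hF.continuous.continuousOn
    have hu0 : u ≠ 0 := fun h => by simp [h] at hu
    refine ⟨F u, hF.pos hu0, fun v => ?_⟩
    rcases eq_or_ne v 0 with rfl | hv
    · simp [hF.map_zero]
    · have hm : (‖v‖⁻¹ • v) ∈ Metric.sphere (0 : EuclideanSpace ℝ (Fin n)) 1 := by
        simp [norm_smul, hv]
      have h1 : F u ≤ F (‖v‖⁻¹ • v) := hmin hm
      rw [hF.homogeneous _ _ (by positivity), inv_mul_eq_div, le_div_iff₀ (by positivity)] at h1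
      exact h1

theorem isOpen_ball (hF : IsMinkowskiNorm F) : IsOpen {v | F v < 1} :=
  isOpen_lt hF.continuous continuous_const

theorem zero_mem_ball (hF : IsMinkowskiNorm F) : (0 : EuclideanSpace ℝ (Fin n)) ∈ {v | F v < 1} := by
  simp [hF.map_zero]

theorem convex_ball (hF : IsMinkowskiNorm F) : Convex ℝ {v | F v < 1} := by
  simpa using hF.convexOn.convex_lt 1

theorem isBounded_ball (hF : IsMinkowskiNorm F) : Bornology.IsBounded {v | F v < 1} := by
  obtain ⟨c, hc, h⟩ := hF.exists_mul_norm_le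
  refine (Metric.isBounded_ball (x := (0 : EuclideanSpace ℝ (Fin n))) (r := 1 / c)).subset
    fun v hv => ?_
  rw [mem_ball_zero_iff, lt_div_iff₀ hc, mul_comm]
  exact (h v).trans_lt hv

end IsMinkowskiNorm

/-! ### The distance function and the intermediate points. -/

section Distance

variable {n : ℕ} {F : EuclideanSpace ℝ (Fin n) → ℝ}

/-- `deriv σ` is uncontrolled at the endpoints, so it is compared on the open interval with
`derivWithin`, which is continuous up to the boundary. -/
theorem intervalIntegrable_of_contDiffOn_Icc {σ : ℝ → EuclideanSpace ℝ (Fin n)} {a b : ℝ}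
    (hab : a < b) (h : ContDiffOn ℝ ∞ σ (Set.Icc a b))
    {G : Type*} [NormedAddCommGroup G] {f : EuclideanSpace ℝ (Fin n) → G} (hf : Continuous f) :
    IntervalIntegrable (fun t => f (deriv σ t)) volume a b := by
  have hc : ContinuousOn (derivWithin σ (Set.Icc a b)) (Set.Icc a b) :=
    h.continuousOn_derivWithin (uniqueDiffOn_Icc hab) (by simp)
  have hi : IntervalIntegrable (fun t => f (derivWithin σ (Set.Icc a b) t)) volume a b :=
    (hf.comp_continuousOn hc).intervalIntegrable_of_Icc hab.le
  rw [intervalIntegrable_iff_integrableOn_Ioo_of_le hab.le] at hi ⊢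
  refine hi.congr_fun (fun t ht => ?_) measurableSet_Ioo
  simp only [derivWithin_of_mem_nhds (Icc_mem_nhds ht.1 ht.2)]

theorem IsPiecewiseSmooth.intervalIntegrable {σ : ℝ → EuclideanSpace ℝ (Fin n)} {r : ℝ}
    (h : IsPiecewiseSmooth σ r) {G : Type*} [NormedAddCommGroup G]
    {f : EuclideanSpace ℝ (Fin n) → G} (hf : Continuous f) :
    IntervalIntegrable (fun t => f (deriv σ t)) volume 0 r := by
  obtain ⟨-, k, τ, h0, hk, hτ⟩ := h
  rw [← h0, ← hk]
  exact IntervalIntegrable.trans_iterate fun i hi =>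
    intervalIntegrable_of_contDiffOn_Icc (hτ i hi).1 (hτ i hi).2 hf

theorem IsPiecewiseSmooth.integral_deriv {σ : ℝ → EuclideanSpace ℝ (Fin n)} {r : ℝ} (hr : 0 ≤ r)
    (h : IsPiecewiseSmooth σ r) : ∫ t in (0 : ℝ)..r, deriv σ t = σ r - σ 0 := by
  have hint := h.intervalIntegrable (f := fun v => v) continuous_id
  obtain ⟨hc, k, τ, h0, hk, hτ⟩ := h
  refine integral_eq_of_hasDerivAt_off_countable_of_le σ (deriv σ) hr
    (s := τ '' Set.Iic k) ((Set.finite_Iic k).image τ).countable hc (fun t ht => ?_) hint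
  -- A time that is not a breakpoint lies in the interior of one smooth piece.
  have key : ∀ j ≤ k, t < τ j → ∃ i < k, τ i < t ∧ t < τ (i + 1) := by
    intro j
    induction j with
    | zero => intro _ h; rw [h0] at h; exact absurd ht.1.1 h.not_gt
    | succ j ih =>
      intro hj h
      rcases lt_trichotomy t (τ j) with h' | h' | h'
      · exact ih (by omega) h'
      · exact absurd ⟨j, by simp; omega, h'.symm⟩ ht.2
      · exact ⟨j, by omega, h', h⟩
  obtain ⟨i, hi, h1, h2⟩ := key k le_rfl (hk ▸ ht.1.2)
  exact (((hτ i hi).2.contDiffAt (Icc_mem_nhds h1 h2)).differentiableAt (by simp)).hasDerivAt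

/-- Jensen's inequality for the convex function `F` and the average velocity; homogeneity cancels
the factor `1 / r`. -/
theorem IsMinkowskiNorm.le_finslerLength (hF : IsMinkowskiNorm F)
    {σ : ℝ → EuclideanSpace ℝ (Fin n)} {r : ℝ} (hr : 0 < r) (h : IsPiecewiseSmooth σ r) :
    F (σ r - σ 0) ≤ finslerLength F σ r := by
  have h1 := h.intervalIntegrable (f := fun v => v) continuous_id
  have h2 := h.intervalIntegrable hF.continuous
  rw [finslerLength, ← h.integral_deriv hr.le]
  rw [intervalIntegrable_iff_integrableOn_Ioc_of_le hr.le] at h1 h2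
  have := hF.convexOn.map_set_average_le (t := Set.Ioc 0 r) (μ := volume)
    (f := fun t => deriv σ t) hF.continuous.continuousOn isClosed_univ (by simp [hr]) (by simp)
    (by simp) h1 h2
  rw [setAverage_eq, setAverage_eq, hF.homogeneous _ _ (by positivity), smul_eq_mul] at this
  rw [intervalIntegral.integral_of_le hr.le, intervalIntegral.integral_of_le hr.le]
  refine le_of_mul_le_mul_left this ?_
  simp [hr]

theorem IsMinkowskiNorm.finslerDist_eq (hF : IsMinkowskiNorm F) (x y : EuclideanSpace ℝ (Fin n)) :
    finslerDist F x y = F (y - x) := by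
  have hmem : F (y - x) ∈ {L : ℝ | ∃ (r : ℝ) (σ : ℝ → EuclideanSpace ℝ (Fin n)), 0 < r ∧
      IsPiecewiseSmooth σ r ∧ σ 0 = x ∧ σ r = y ∧ L = finslerLength F σ r} := by
    have hs : ContDiff ℝ ∞ fun t : ℝ => x + t • (y - x) := by fun_prop
    refine ⟨1, fun t => x + t • (y - x), one_pos, ⟨hs.continuous.continuousOn, 1, fun i => i,
      by simp, by simp, fun i _ => ⟨by simp, hs.contDiffOn⟩⟩, by simp, by simp, ?_⟩
    have : ∀ t : ℝ, deriv (fun t : ℝ => x + t • (y - x)) t = y - x := fun t => by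
      simpa using (((hasDerivAt_id t).smul_const (y - x)).const_add x).deriv
    simp [finslerLength, this]
  have hle : ∀ L ∈ {L : ℝ | ∃ (r : ℝ) (σ : ℝ → EuclideanSpace ℝ (Fin n)), 0 < r ∧
      IsPiecewiseSmooth σ r ∧ σ 0 = x ∧ σ r = y ∧ L = finslerLength F σ r}, F (y - x) ≤ L := by
    rintro L ⟨r, σ, hr, hσ, rfl, rfl, rfl⟩
    exact hF.le_finslerLength hr hσ
  exact (IsLeast.csInf_eq ⟨hmem, hle⟩)

open Pointwise in
theorem IsMinkowskiNorm.interpolationSet_eq (hF : IsMinkowskiNorm F) {s : ℝ} (hs₀ : 0 < s)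
    (hs₁ : s < 1) (A B : Set (EuclideanSpace ℝ (Fin n))) :
    interpolationSet F s A B = (1 - s) • A + s • B := by
  have key : ∀ x y z : EuclideanSpace ℝ (Fin n),
      z ∈ intermediatePoints F s x y ↔ (1 - s) • x + s • y = z := by
    intro x y z
    simp only [intermediatePoints, hF.finslerDist_eq, Set.mem_ofPred_eq]
    constructor
    · rintro ⟨h1, h2⟩
      rcases eq_or_ne y x with rfl | hxy
      · rw [sub_self, hF.map_zero, mul_zero, hF.eq_zero_iff, sub_eq_zero] at h1
        rw [h1, ← add_smul]; simp
      · have hD := hF.pos (sub_ne_zero.2 hxy)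
        have hs' : 0 < 1 - s := by linarith
        have hv : z - x ≠ 0 := fun h => by
          rw [h, hF.map_zero] at h1; exact (mul_pos hs₀ hD).ne h1
        have hw : y - z ≠ 0 := fun h => by
          rw [h, hF.map_zero] at h2; exact (mul_pos hs' hD).ne h2
        by_contra hne
        -- The two distances add up to `F (y - x)`, so the triangle inequality is an equality and `z
        -- - x`, `y - z` point in the same direction. Comparing their lengths gives `(1 - s) • (z -
        -- x) = s • (y - z)`, which determines `z`.
        have := hF.add_lt hv hw fun h => hne <| by
          rw [h1, h2, mul_inv, mul_inv, mul_comm, mul_comm (1 - s)⁻¹, mul_smul, mul_smul] at h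
          have h := smul_right_injective _ (inv_ne_zero hD.ne') h
          have h : (s * (1 - s)) • s⁻¹ • (z - x) = (s * (1 - s)) • (1 - s)⁻¹ • (y - z) :=
            congrArg _ h
          rw [smul_smul, smul_smul, mul_right_comm, mul_inv_cancel₀ hs₀.ne', one_mul, mul_assoc,
            mul_inv_cancel₀ hs'.ne', mul_one, ← sub_eq_zero] at h
          rw [← sub_eq_zero, ← neg_eq_zero, ← h]
          module
        rw [h1, h2, show z - x + (y - z) = y - x by abel] at this
        linarith
    · rintro rfl
      rw [← hF.homogeneous _ _ hs₀.le, ← hF.homogeneous _ _ (by linarith)]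
      constructor <;> congr 1 <;> module
  ext z
  simp only [interpolationSet, Set.mem_iUnion, key, Set.mem_add, Set.mem_smul_set]
  constructor
  · rintro ⟨x, hx, y, hy, h⟩
    exact ⟨_, ⟨x, hx, rfl⟩, _, ⟨y, hy, rfl⟩, h⟩
  · rintro ⟨_, ⟨x, hx, rfl⟩, _, ⟨y, hy, rfl⟩, h⟩
    exact ⟨x, hx, y, hy, h⟩

end Distance

/-! ### The Brunn–Minkowski inequality via Prékopa–Leindler. -/

section BrunnMinkowski

open Set Bornology
open scoped Pointwise

/-- The translates `K + min L` and `max K + L` both lie in `K + L` and meet in at most one point. -/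
theorem Real.volume_add_le_of_isCompact {K L : Set ℝ} (hK : IsCompact K) (hL : IsCompact L)
    (hK' : K.Nonempty) (hL' : L.Nonempty) : volume K + volume L ≤ volume (K + L) := by
  obtain ⟨a, ha, hmax⟩ := hK.exists_isGreatest hK'
  obtain ⟨b, hb, hmin⟩ := hL.exists_isLeast hL'
  have h1 : volume K = volume ((fun x => x + b) '' K) := by
    rw [image_add_right, measure_preimage_add_right]
  have h2 : volume L = volume ((fun x => a + x) '' L) := by
    rw [image_add_left, measure_preimage_add]
  have hd : AEDisjoint volume ((fun x => x + b) '' K) ((fun x => a + x) '' L) := by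
    refine measure_mono_null (t := {a + b}) ?_ (by simp)
    rintro _ ⟨⟨x, hx, rfl⟩, ⟨y, hy, hxy⟩⟩
    have := hmax hx
    have := hmin hy
    simp only [mem_singleton_iff] at hxy ⊢
    linarith
  have hm : MeasurableSet ((fun x => a + x) '' L) :=
    (hL.image (by fun_prop)).isClosed.measurableSet
  rw [h1, h2, ← measure_union₀ hm.nullMeasurableSet hd]
  refine measure_mono (union_subset ?_ ?_)
  · rintro _ ⟨x, hx, rfl⟩
    exact add_mem_add hx hb
  · rintro _ ⟨x, hx, rfl⟩
    exact add_mem_add ha hx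

/-- The one-dimensional Brunn–Minkowski inequality. -/
theorem Real.volume_add_le {A B : Set ℝ} (hA : MeasurableSet A) (hB : MeasurableSet B)
    (hA' : A.Nonempty) (hB' : B.Nonempty) : volume A + volume B ≤ volume (A + B) := by
  obtain ⟨a, ha⟩ := hA'
  obtain ⟨b, hb⟩ := hB'
  rw [hA.measure_eq_iSup_isCompact, hB.measure_eq_iSup_isCompact]
  simp only [iSup_and', iSup_subtype']
  have : Nonempty {K : Set ℝ // K ⊆ A ∧ IsCompact K} := ⟨⟨∅, by simp⟩⟩
  have : Nonempty {K : Set ℝ // K ⊆ B ∧ IsCompact K} := ⟨⟨∅, by simp⟩⟩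
  refine ENNReal.iSup_add_iSup_le fun ⟨K, hK, hKc⟩ ⟨L, hL, hLc⟩ => ?_
  -- The approximating compact sets may be empty; inserting `a` and `b` makes them nonempty.
  calc volume K + volume L ≤ volume (insert a K) + volume (insert b L) :=
        add_le_add (measure_mono (subset_insert _ _)) (measure_mono (subset_insert _ _))
    _ ≤ volume (insert a K + insert b L) :=
        Real.volume_add_le_of_isCompact (hKc.insert a) (hLc.insert b) (by simp) (by simp)
    _ ≤ volume (A + B) :=
        measure_mono (add_subset_add (insert_subset ha hK) (insert_subset hb hL))

theorem ENNReal.rpow_mul_rpow_le_add {s : ℝ} (hs₀ : 0 < s) (hs₁ : s < 1) (a b : ℝ≥0∞) :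
    a ^ (1 - s) * b ^ s ≤ ENNReal.ofReal (1 - s) * a + ENNReal.ofReal s * b := by
  have hs' : 0 < 1 - s := by linarith
  rcases eq_or_ne a ⊤ with rfl | ha
  · rw [ENNReal.mul_top (by simpa using hs'), top_add]
    exact le_top
  rcases eq_or_ne b ⊤ with rfl | hb
  · rw [ENNReal.mul_top (by simpa using hs₀), add_top]
    exact le_top
  lift a to NNReal using ha
  lift b to NNReal using hb
  have := NNReal.geom_mean_le_arith_mean2_weighted (1 - s).toNNReal s.toNNReal a b
    (by rw [← Real.toNNReal_add hs'.le hs₀.le]; simp)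
  rw [Real.coe_toNNReal _ hs'.le, Real.coe_toNNReal _ hs₀.le] at this
  rw [← ENNReal.coe_rpow_of_nonneg _ hs'.le, ← ENNReal.coe_rpow_of_nonneg _ hs₀.le,
    ENNReal.ofReal, ENNReal.ofReal]
  exact_mod_cast this

/-- The Prékopa–Leindler inequality on the line, arithmetic form for functions with supremum
one. -/
theorem prekopaLeindler_of_isLUB_one {s : ℝ} (hs₀ : 0 < s) (hs₁ : s < 1) {f g h : ℝ → ℝ}
    (hf : Measurable f) (hg : Measurable g) (hh : Measurable h) (hf0 : 0 ≤ f) (hg0 : 0 ≤ g)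
    (hh0 : 0 ≤ h) (hf1 : IsLUB (range f) 1) (hg1 : IsLUB (range g) 1)
    (H : ∀ x y, f x ^ (1 - s) * g y ^ s ≤ h ((1 - s) * x + s * y)) :
    ENNReal.ofReal (1 - s) * (∫⁻ x, ENNReal.ofReal (f x)) +
      ENNReal.ofReal s * (∫⁻ x, ENNReal.ofReal (g x)) ≤ ∫⁻ x, ENNReal.ofReal (h x) := by
  have hs' : 0 < 1 - s := by linarith
  -- Layer cake formula. For `t < 1` the superlevel sets of `f` and `g` are nonempty because both
  -- suprema are one, and their weighted sum lies in that of `h`; for `t ≥ 1` they are empty.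
  rw [lintegral_eq_lintegral_meas_lt _ (.of_forall hf0) hf.aemeasurable,
    lintegral_eq_lintegral_meas_lt _ (.of_forall hg0) hg.aemeasurable,
    lintegral_eq_lintegral_meas_lt _ (.of_forall hh0) hh.aemeasurable,
    ← lintegral_const_mul' _ _ ENNReal.ofReal_ne_top,
    ← lintegral_const_mul' _ _ ENNReal.ofReal_ne_top, ← lintegral_add_left]
  · refine setLIntegral_mono' measurableSet_Ioi fun t ht => ?_
    have ht : 0 < t := ht
    rcases lt_or_ge t 1 with ht1 | ht1
    · obtain ⟨_, ⟨x, rfl⟩, hx⟩ := (lt_isLUB_iff hf1).1 ht1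
      obtain ⟨_, ⟨y, rfl⟩, hy⟩ := (lt_isLUB_iff hg1).1 ht1
      have e1 : ENNReal.ofReal (1 - s) * volume {a | t < f a} =
          volume ((1 - s) • {a | t < f a}) := by
        rw [Measure.addHaar_smul]; simp [abs_of_pos hs']
      have e2 : ENNReal.ofReal s * volume {a | t < g a} = volume (s • {a | t < g a}) := by
        rw [Measure.addHaar_smul]; simp [abs_of_pos hs₀]
      rw [e1, e2]
      refine (Real.volume_add_le ((measurableSet_lt measurable_const hf).const_smul₀ _)
        ((measurableSet_lt measurable_const hg).const_smul₀ _)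
        (Set.Nonempty.smul_set ⟨x, hx⟩) (Set.Nonempty.smul_set ⟨y, hy⟩)).trans (measure_mono ?_)
      rintro _ ⟨_, ⟨x, hx, rfl⟩, _, ⟨y, hy, rfl⟩, rfl⟩
      have hx : t < f x := hx
      have hy : t < g y := hy
      calc t = t ^ (1 - s) * t ^ s := by
            rw [← Real.rpow_add ht]; simp
        _ < f x ^ (1 - s) * g y ^ s :=
            mul_lt_mul'' (Real.rpow_lt_rpow ht.le hx hs') (Real.rpow_lt_rpow ht.le hy hs₀)
              (by positivity) (by positivity)
        _ ≤ _ := H x y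
    · have e1 : {a | t < f a} = ∅ := by
        ext a; simpa using (hf1.1 ⟨a, rfl⟩).trans ht1
      have e2 : {a | t < g a} = ∅ := by
        ext a; simpa using (hg1.1 ⟨a, rfl⟩).trans ht1
      simp [e1, e2]
  · refine Measurable.const_mul (Antitone.measurable fun a b hab => measure_mono fun x hx => ?_) _
    exact hab.trans_lt hx

/-- The Prékopa–Leindler inequality on the line for bounded functions. -/
theorem prekopaLeindler_real {s : ℝ} (hs₀ : 0 < s) (hs₁ : s < 1) {f g h : ℝ → ℝ}
    (hf : Measurable f) (hg : Measurable g) (hh : Measurable h) (hf0 : 0 ≤ f) (hg0 : 0 ≤ g)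
    (hh0 : 0 ≤ h) (hfb : BddAbove (range f)) (hgb : BddAbove (range g))
    (H : ∀ x y, f x ^ (1 - s) * g y ^ s ≤ h ((1 - s) * x + s * y)) :
    (∫⁻ x, ENNReal.ofReal (f x)) ^ (1 - s) * (∫⁻ x, ENNReal.ofReal (g x)) ^ s ≤
      ∫⁻ x, ENNReal.ofReal (h x) := by
  have hs' : 0 < 1 - s := by linarith
  have hlub : ∀ {f : ℝ → ℝ}, 0 ≤ f → BddAbove (range f) → ∫⁻ x, ENNReal.ofReal (f x) ≠ 0 →
      ∃ M > 0, IsLUB (range fun x => M⁻¹ * f x) 1 := by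
    intro f hf0 hfb hI
    have hM : 0 < sSup (range f) := by
      by_contra hM
      refine hI ?_
      have : ∀ x, f x ≤ 0 := fun x => (le_csSup hfb ⟨x, rfl⟩).trans (not_lt.1 hM)
      simp [ENNReal.ofReal_of_nonpos (this _)]
    refine ⟨_, hM, ?_⟩
    have := (isLUB_csSup (range_nonempty f) hfb).mul_left (inv_nonneg.2 hM.le)
    rwa [inv_mul_cancel₀ hM.ne', ← range_comp] at this
  by_cases hI : ∫⁻ x, ENNReal.ofReal (f x) = 0
  · simp [hI, hs']
  by_cases hJ : ∫⁻ x, ENNReal.ofReal (g x) = 0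
  · simp [hJ, hs₀]
  obtain ⟨M, hM, hM'⟩ := hlub hf0 hfb hI
  obtain ⟨N, hN, hN'⟩ := hlub hg0 hgb hJ
  -- Dividing `f` and `g` by their suprema scales the hypothesis by exactly `c`. After AM–GM the
  -- same factor appears on both sides and cancels.
  set c : ℝ := (M⁻¹) ^ (1 - s) * (N⁻¹) ^ s with hc
  have hc0 : 0 < c := by positivity
  have key := prekopaLeindler_of_isLUB_one hs₀ hs₁ (hf.const_mul M⁻¹) (hg.const_mul N⁻¹)
    (hh.const_mul c) (fun x => mul_nonneg (by positivity) (hf0 x))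
    (fun x => mul_nonneg (by positivity) (hg0 x)) (fun x => mul_nonneg (by positivity) (hh0 x))
    hM' hN' fun x y => by
      rw [Real.mul_rpow (by positivity) (hf0 x), Real.mul_rpow (by positivity) (hg0 y),
        mul_mul_mul_comm]
      exact mul_le_mul_of_nonneg_left (H x y) hc0.le
  have hcm : ∀ {d : ℝ} (φ : ℝ → ℝ), 0 < d →
      ∫⁻ x, ENNReal.ofReal (d * φ x) = ENNReal.ofReal d * ∫⁻ x, ENNReal.ofReal (φ x) := by
    intro d φ hd
    rw [← lintegral_const_mul' _ _ ENNReal.ofReal_ne_top]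
    simp [ENNReal.ofReal_mul hd.le]
  rw [hcm _ (inv_pos.2 hM), hcm _ (inv_pos.2 hN), hcm _ hc0] at key
  have key := (ENNReal.rpow_mul_rpow_le_add hs₀ hs₁ _ _).trans key
  rw [ENNReal.mul_rpow_of_nonneg _ _ hs'.le, ENNReal.mul_rpow_of_nonneg _ _ hs₀.le,
    mul_mul_mul_comm, ENNReal.ofReal_rpow_of_pos (inv_pos.2 hM),
    ENNReal.ofReal_rpow_of_pos (inv_pos.2 hN), ← ENNReal.ofReal_mul (by positivity), ← hc] at key
  exact (ENNReal.mul_le_mul_iff_right (by simpa using hc0) ENNReal.ofReal_ne_top).1 key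

/-- The Brunn–Minkowski inequality in multiplicative form, for bounded open sets. -/
def MulBrunnMinkowski {E : Type*} [NormedAddCommGroup E] [NormedSpace ℝ E] [MeasurableSpace E]
    (μ : Measure E) : Prop :=
  ∀ ⦃s : ℝ⦄, 0 < s → s < 1 → ∀ ⦃A B : Set E⦄, IsOpen A → IsOpen B → IsBounded A → IsBounded B →
    μ A ^ (1 - s) * μ B ^ s ≤ μ ((1 - s) • A + s • B)

variable {E : Type*} [NormedAddCommGroup E] [NormedSpace ℝ E] [MeasurableSpace E] [BorelSpace E]
  [FiniteDimensional ℝ E]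

/-- By Fubini, the measure of a set is the integral of its slice volumes. The inequality in `E`,
applied to the slices at `x` and `y`, is the Prékopa–Leindler hypothesis for these functions;
boundedness keeps them finite. -/
theorem MulBrunnMinkowski.prod {μ : Measure E} [μ.IsAddHaarMeasure] (h : MulBrunnMinkowski μ) :
    MulBrunnMinkowski ((volume : Measure ℝ).prod μ) := by
  intro s hs₀ hs₁ A B hA hB hAb hBb
  have hs' : 0 < 1 - s := by linarith
  have : ProperSpace E := FiniteDimensional.proper_real E
  set C := (1 - s) • A + s • B with hC
  have hCo : IsOpen C := (hA.smul₀ hs'.ne').add_right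
  have hCb : IsBounded C := (hAb.smul₀ _).add (hBb.smul₀ _)
  have hsec : ∀ {D : Set (ℝ × E)} (t : ℝ), IsBounded D → IsBounded (Prod.mk t ⁻¹' D) :=
    fun t hD => (hD.image_snd).subset fun x hx => ⟨_, hx, rfl⟩
  have hmeas : ∀ {D : Set (ℝ × E)}, IsOpen D → IsBounded D →
      (volume : Measure ℝ).prod μ D =
        ∫⁻ t, ENNReal.ofReal (μ (Prod.mk t ⁻¹' D)).toReal := fun {D} hD hDb => by
    rw [Measure.prod_apply hD.measurableSet]
    congr 1 with t
    rw [ENNReal.ofReal_toReal (hsec t hDb).measure_lt_top.ne]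
  have hm : ∀ {D : Set (ℝ × E)}, IsOpen D →
      Measurable fun t => (μ (Prod.mk t ⁻¹' D)).toReal :=
    fun hD => (measurable_measure_prodMk_left hD.measurableSet).ennreal_toReal
  have hbd : ∀ {D : Set (ℝ × E)}, IsBounded D →
      BddAbove (range fun t => (μ (Prod.mk t ⁻¹' D)).toReal) := fun {D} hD => by
    refine ⟨(μ (Prod.snd '' D)).toReal, ?_⟩
    rintro _ ⟨t, rfl⟩
    exact ENNReal.toReal_mono hD.image_snd.measure_lt_top.ne
      (measure_mono fun x hx => ⟨_, hx, rfl⟩)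
  rw [hmeas hA hAb, hmeas hB hBb, hmeas hCo hCb]
  refine prekopaLeindler_real hs₀ hs₁ (hm hA) (hm hB) (hm hCo) (fun t => ENNReal.toReal_nonneg)
    (fun t => ENNReal.toReal_nonneg) (fun t => ENNReal.toReal_nonneg) (hbd hAb) (hbd hBb)
    fun x y => ?_
  have hsub : (1 - s) • (Prod.mk x ⁻¹' A) + s • (Prod.mk y ⁻¹' B) ⊆
      Prod.mk ((1 - s) * x + s * y) ⁻¹' C := by
    rintro _ ⟨_, ⟨a, ha, rfl⟩, _, ⟨b, hb, rfl⟩, rfl⟩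
    exact ⟨_, ⟨_, ha, rfl⟩, _, ⟨_, hb, rfl⟩, by simp⟩
  have := (h hs₀ hs₁ (hA.preimage (by fun_prop)) (hB.preimage (by fun_prop)) (hsec x hAb)
    (hsec y hBb)).trans (measure_mono hsub)
  rw [ENNReal.toReal_rpow, ENNReal.toReal_rpow, ← ENNReal.toReal_mul]
  exact ENNReal.toReal_mono (hsec _ hCb).measure_lt_top.ne this

/-- Haar measures differ by a constant `c`, and `c ^ (1 - s) * c ^ s = c`, so both sides scale
alike. -/
theorem MulBrunnMinkowski.of_equiv {E' : Type*} [NormedAddCommGroup E'] [NormedSpace ℝ E']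
    [MeasurableSpace E'] [BorelSpace E'] [FiniteDimensional ℝ E'] {μ : Measure E}
    [μ.IsAddHaarMeasure] (h : MulBrunnMinkowski μ) (e : E ≃L[ℝ] E') (ν : Measure E')
    [ν.IsAddHaarMeasure] : MulBrunnMinkowski ν := by
  intro s hs₀ hs₁ A B hA hB hAb hBb
  have hs' : 0 < 1 - s := by linarith
  have hν := Measure.isAddLeftInvariant_eq_smul ν (μ.map e)
  set c := ν.addHaarScalarFactor (μ.map e)
  have hap : ∀ D : Set E', ν D = c * μ (e ⁻¹' D) := fun D => by
    have he : μ.map e D = μ (e ⁻¹' D) := e.toHomeomorph.toMeasurableEquiv.map_apply D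
    rw [hν, Measure.smul_apply, he]
    rfl
  have hb : ∀ {D : Set E'}, IsBounded D → IsBounded (e ⁻¹' D) := fun {D} hD => by
    rw [← e.image_symm_eq_preimage]
    exact e.symm.lipschitz.isBounded_image hD
  have := h hs₀ hs₁ (hA.preimage e.continuous) (hB.preimage e.continuous) (hb hAb) (hb hBb)
  have hpre : (1 - s) • (e ⁻¹' A) + s • (e ⁻¹' B) ⊆ e ⁻¹' ((1 - s) • A + s • B) := by
    rintro _ ⟨_, ⟨a, ha, rfl⟩, _, ⟨b, hb, rfl⟩, rfl⟩
    exact ⟨_, ⟨_, ha, rfl⟩, _, ⟨_, hb, rfl⟩, by simp⟩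
  rw [hap, hap, hap, ENNReal.mul_rpow_of_nonneg _ _ hs'.le, ENNReal.mul_rpow_of_nonneg _ _ hs₀.le,
    mul_mul_mul_comm, ← ENNReal.rpow_add_of_nonneg _ _ hs'.le hs₀.le]
  simpa using mul_le_mul_right (this.trans (measure_mono hpre)) (c : ℝ≥0∞)

theorem mulBrunnMinkowski_pi (k : ℕ) :
    MulBrunnMinkowski (volume : Measure (Fin k → ℝ)) := by
  induction k with
  | zero =>
    intro s hs₀ hs₁ A B _ _ _ _
    have hs' : 0 < 1 - s := by linarith
    rcases A.eq_empty_or_nonempty with rfl | hA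
    · simp [hs']
    rcases B.eq_empty_or_nonempty with rfl | hB
    · simp [hs₀]
    have : ∀ D : Set (Fin 0 → ℝ), D.Nonempty → volume D = 1 := fun D hD => by
      rw [Subsingleton.eq_univ_of_nonempty hD]
      simp [volume_pi]
    rw [this A hA, this B hB, this _ (hA.smul_set.add hB.smul_set)]
    simp
  | succ k ih => exact ih.prod.of_equiv (Fin.consEquivL ℝ fun _ : Fin (k + 1) => ℝ) _

theorem mulBrunnMinkowski (μ : Measure E) [μ.IsAddHaarMeasure] : MulBrunnMinkowski μ :=
  (mulBrunnMinkowski_pi (Module.finrank ℝ E)).of_equiv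
    (ContinuousLinearEquiv.ofFinrankEq (by simp)) μ

theorem addHaar_smul_of_pos (μ : Measure E) [μ.IsAddHaarMeasure] {a b : ℝ} (ha : 0 ≤ a)
    {A : Set E} (hA : μ A = ENNReal.ofReal (b ^ Module.finrank ℝ E)) :
    μ (a • A) = ENNReal.ofReal ((a * b) ^ Module.finrank ℝ E) := by
  rw [Measure.addHaar_smul, hA, ← ENNReal.ofReal_mul (abs_nonneg _), abs_of_nonneg (by positivity),
    mul_pow]

/-- The Brunn–Minkowski inequality for bounded open sets. -/
theorem brunnMinkowski (μ : Measure E) [μ.IsAddHaarMeasure] {A B : Set E} (hA : IsOpen A)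
    (hB : IsOpen B) (hAb : IsBounded A) (hBb : IsBounded B) {a b : ℝ} (ha : 0 < a) (hb : 0 < b)
    (hμA : μ A = ENNReal.ofReal (a ^ Module.finrank ℝ E))
    (hμB : μ B = ENNReal.ofReal (b ^ Module.finrank ℝ E)) :
    ENNReal.ofReal ((a + b) ^ Module.finrank ℝ E) ≤ μ (A + B) := by
  have hab : 0 < a + b := by positivity
  have hA1 : μ (a⁻¹ • A) = 1 := by
    rw [addHaar_smul_of_pos μ (inv_nonneg.2 ha.le) hμA, inv_mul_cancel₀ ha.ne']; simp
  have hB1 : μ (b⁻¹ • B) = 1 := by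
    rw [addHaar_smul_of_pos μ (inv_nonneg.2 hb.le) hμB, inv_mul_cancel₀ hb.ne']; simp
  have hs₁ : b / (a + b) < 1 := by rw [div_lt_one hab]; linarith
  -- With this weight, the combination of `a⁻¹ • A` and `b⁻¹ • B` is `(a + b)⁻¹ • (A + B)`.
  have key := mulBrunnMinkowski μ (s := b / (a + b)) (by positivity) hs₁
    (hA.smul₀ (inv_ne_zero ha.ne')) (hB.smul₀ (inv_ne_zero hb.ne')) (hAb.smul₀ _) (hBb.smul₀ _)
  have e1 : (1 - b / (a + b)) * a⁻¹ = (a + b)⁻¹ := by field_simp; ring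
  have e2 : b / (a + b) * b⁻¹ = (a + b)⁻¹ := by field_simp
  rw [hA1, hB1, ENNReal.one_rpow, ENNReal.one_rpow, mul_one, smul_smul, smul_smul, e1, e2,
    ← smul_add, Measure.addHaar_smul, abs_of_nonneg (by positivity), inv_pow] at key
  calc ENNReal.ofReal ((a + b) ^ Module.finrank ℝ E)
      = ENNReal.ofReal ((a + b) ^ Module.finrank ℝ E) * 1 := (mul_one _).symm
    _ ≤ ENNReal.ofReal ((a + b) ^ Module.finrank ℝ E) *
        (ENNReal.ofReal ((a + b) ^ Module.finrank ℝ E)⁻¹ * μ (A + B)) := by gcongr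
    _ = μ (A + B) := by
      rw [← mul_assoc, ← ENNReal.ofReal_mul (by positivity), mul_inv_cancel₀ (by positivity)]
      simp

theorem brunnMinkowski_convexComb (μ : Measure E) [μ.IsAddHaarMeasure] {A B : Set E}
    (hA : IsOpen A) (hB : IsOpen B) (hAb : IsBounded A) (hBb : IsBounded B) {a b s : ℝ}
    (ha : 0 < a) (hb : 0 < b) (hμA : μ A = ENNReal.ofReal (a ^ Module.finrank ℝ E))
    (hμB : μ B = ENNReal.ofReal (b ^ Module.finrank ℝ E)) (hs₀ : 0 < s) (hs₁ : s < 1) :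
    ENNReal.ofReal (((1 - s) * a + s * b) ^ Module.finrank ℝ E) ≤ μ ((1 - s) • A + s • B) := by
  have hs' : 0 < 1 - s := by linarith
  exact brunnMinkowski μ (hA.smul₀ hs'.ne') (hB.smul₀ hs₀.ne') (hAb.smul₀ _) (hBb.smul₀ _)
    (by positivity) (by positivity) (addHaar_smul_of_pos μ hs'.le hμA)
    (addHaar_smul_of_pos μ hs₀.le hμB)

end BrunnMinkowski

/-! ### The equality case at volume one, by slicing with hyperplanes. -/

section BrunnMinkowskiEquality

open Set Bornology Filter Topology
open scoped Pointwise

/-- If a weighted sum of two continuous functions of independent variables is minimal along the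
diagonal at fixed weighted mean of the variables, then the functions differ by a constant. -/
theorem exists_eq_add_const_of_convexComb_le {s : ℝ} (hs₀ : 0 < s) (hs₁ : s < 1) {φ ψ : ℝ → ℝ}
    (hφ : ContinuousOn φ (Ioo 0 1)) (hψ : ContinuousOn ψ (Ioo 0 1))
    (h : ∀ a ∈ Ioo (0 : ℝ) 1, ∀ b ∈ Ioo (0 : ℝ) 1,
      (1 - s) * φ ((1 - s) * a + s * b) + s * ψ ((1 - s) * a + s * b) ≤
        (1 - s) * φ a + s * ψ b) :
    ∃ k, ∀ a ∈ Ioo (0 : ℝ) 1, ψ a = φ a + k := by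
  have hs' : 0 < 1 - s := by linarith
  suffices H : ∀ α ∈ Ioo (0 : ℝ) 1, ∀ β ∈ Ioo (0 : ℝ) 1, α < β → ψ β - φ β = ψ α - φ α by
    refine ⟨ψ (1 / 2) - φ (1 / 2), fun a ha => ?_⟩
    rcases lt_trichotomy a (1 / 2) with h | h | h
    · linarith [H a ha (1 / 2) (by norm_num) h]
    · subst h; ring
    · linarith [H (1 / 2) (by norm_num) a ha h]
  intro α hα β hβ hαβ
  have hint : ∀ {χ : ℝ → ℝ}, ContinuousOn χ (Ioo 0 1) → ∀ x ∈ Ioo (0 : ℝ) 1,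
      ∀ y ∈ Ioo (0 : ℝ) 1, IntervalIntegrable χ volume x y := fun hχ x hx y hy =>
    (hχ.mono (ordConnected_Ioo.uIcc_subset hx hy)).intervalIntegrable
  have hder : ∀ {χ : ℝ → ℝ}, ContinuousOn χ (Ioo 0 1) → ∀ x ∈ Ioo (0 : ℝ) 1,
      HasDerivAt (fun u => ∫ t in α..u, χ t) (χ x) x := fun hχ x hx =>
    intervalIntegral.integral_hasDerivAt_right (hint hχ α hα x hx)
      (hχ.stronglyMeasurableAtFilter isOpen_Ioo x hx) (hχ.continuousAt (isOpen_Ioo.mem_nhds hx))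
  -- `Φ ε` is the integral over `[α, β]` of `(1 - s) φ (t + s ε) + s ψ (t - (1 - s) ε)`. The
  -- weighted mean of the two arguments is always `t`, so `Φ` is minimal at `0`. With `ε` moved into
  -- the limits of integration, `Φ` is differentiable for merely continuous `φ` and `ψ`, and `Φ' 0 =
  -- 0` is the claim.
  set Φ : ℝ → ℝ := fun ε =>
    (1 - s) * ((∫ t in α..β + s * ε, φ t) - ∫ t in α..α + s * ε, φ t) +
      s * ((∫ t in α..β + -(1 - s) * ε, ψ t) - ∫ t in α..α + -(1 - s) * ε, ψ t) with hΦ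
  have hshift : ∀ {χ : ℝ → ℝ}, ContinuousOn χ (Ioo 0 1) → ∀ x ∈ Ioo (0 : ℝ) 1, ∀ d : ℝ,
      HasDerivAt (fun ε => ∫ t in α..x + d * ε, χ t) (χ x * d) 0 := fun {χ} hχ x hx d => by
    have h1 : HasDerivAt (fun ε : ℝ => x + d * ε) d 0 := by
      simpa using ((hasDerivAt_id (0 : ℝ)).const_mul d).const_add x
    have h2 : HasDerivAt (fun u => ∫ t in α..u, χ t) (χ x) (x + d * 0) := by
      rw [mul_zero, add_zero]
      exact hder hχ x hx
    exact HasDerivAt.comp (h := fun ε : ℝ => x + d * ε) (0 : ℝ) h2 h1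
  have hΦ' : HasDerivAt Φ ((1 - s) * (φ β * s - φ α * s) +
      s * (ψ β * -(1 - s) - ψ α * -(1 - s))) 0 :=
    (((hshift hφ β hβ s).sub (hshift hφ α hα s)).const_mul _).add
      (((hshift hψ β hβ _).sub (hshift hψ α hα _)).const_mul _)
  have hnear : ∀ x ∈ Ioo (0 : ℝ) 1, ∀ d : ℝ, ∀ᶠ ε in 𝓝 (0 : ℝ), x + d * ε ∈ Ioo (0 : ℝ) 1 :=
    fun x hx d => by
      have : ContinuousAt (fun ε : ℝ => x + d * ε) 0 := by fun_prop
      exact this (by simpa using isOpen_Ioo.mem_nhds hx)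
  have hmin : IsLocalMin Φ 0 := by
    filter_upwards [hnear α hα s, hnear β hβ s, hnear α hα (-(1 - s)), hnear β hβ (-(1 - s))]
      with ε h1 h2 h3 h4
    have e : ∀ {χ : ℝ → ℝ}, ContinuousOn χ (Ioo 0 1) → ∀ d, α + d ∈ Ioo (0 : ℝ) 1 →
        β + d ∈ Ioo (0 : ℝ) 1 →
        (∫ t in α..β + d, χ t) - (∫ t in α..α + d, χ t) = ∫ t in α..β, χ (t + d) :=
      fun {χ} hχ d hd1 hd2 => by
        rw [intervalIntegral.integral_interval_sub_left (hint hχ _ hα _ hd2) (hint hχ _ hα _ hd1),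
          intervalIntegral.integral_comp_add_right]
    have hi : ∀ {χ : ℝ → ℝ}, ContinuousOn χ (Ioo 0 1) → ∀ d, α + d ∈ Ioo (0 : ℝ) 1 →
        β + d ∈ Ioo (0 : ℝ) 1 → IntervalIntegrable (fun t => χ (t + d)) volume α β :=
      fun {χ} hχ d hd1 hd2 => by
        simpa using (hint hχ _ hd1 _ hd2).comp_add_right d
    have e0 : Φ 0 = ∫ t in α..β, ((1 - s) * φ t + s * ψ t) := by
      rw [intervalIntegral.integral_add ((hint hφ _ hα _ hβ).const_mul _)
        ((hint hψ _ hα _ hβ).const_mul _)]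
      simp [hΦ]
    rw [e0, hΦ]
    simp only
    rw [e hφ _ h1 h2, e hψ _ h3 h4, ← intervalIntegral.integral_const_mul,
      ← intervalIntegral.integral_const_mul,
      ← intervalIntegral.integral_add ((hi hφ _ h1 h2).const_mul _) ((hi hψ _ h3 h4).const_mul _)]
    refine intervalIntegral.integral_mono_on hαβ.le
      (((hint hφ _ hα _ hβ).const_mul _).add ((hint hψ _ hα _ hβ).const_mul _))
      (((hi hφ _ h1 h2).const_mul _).add ((hi hψ _ h3 h4).const_mul _)) fun t ht => ?_
    have := h (t + s * ε) ⟨by linarith [h1.1, ht.1], by linarith [h2.2, ht.2]⟩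
      (t + -(1 - s) * ε) ⟨by linarith [h3.1, ht.1], by linarith [h4.2, ht.2]⟩
    rwa [show (1 - s) * (t + s * ε) + s * (t + -(1 - s) * ε) = t by ring] at this
  have h0 := hmin.hasDerivAt_eq_zero hΦ'
  have h1 : (s * (1 - s)) * ((φ β - φ α) - (ψ β - ψ α)) = 0 := by linarith
  have h2 := (mul_eq_zero.1 h1).resolve_left (by positivity)
  linarith

variable {E : Type*} [NormedAddCommGroup E] [NormedSpace ℝ E] [MeasurableSpace E] [BorelSpace E]
  [FiniteDimensional ℝ E] {μ : Measure E} [μ.IsAddHaarMeasure] {f : E →L[ℝ] ℝ} {A B : Set E}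

theorem measure_hyperplane (μ : Measure E) [μ.IsAddHaarMeasure] (hf : f ≠ 0) (t : ℝ) :
    μ {x | f x = t} = 0 := by
  rcases {x | f x = t}.eq_empty_or_nonempty with h | ⟨x₀, hx₀⟩
  · rw [h, measure_empty]
  · have hx₀ : f x₀ = t := hx₀
    have : {x | f x = t} = (fun x => x + -x₀) ⁻¹' (LinearMap.ker (f : E →ₗ[ℝ] ℝ) : Set E) := by
      ext x
      simp [hx₀, ← sub_eq_add_neg, sub_eq_zero]
    rw [this, measure_preimage_add_right]
    refine Measure.addHaar_submodule μ _ fun h => hf ?_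
    ext x
    have : x ∈ LinearMap.ker (f : E →ₗ[ℝ] ℝ) := h ▸ Submodule.mem_top
    simpa using this

/-- The volume of the part of `A` below the level `t` of the functional `f`. -/
def lowerVolume (μ : Measure E) (f : E →L[ℝ] ℝ) (A : Set E) (t : ℝ) : ℝ :=
  μ.real (A ∩ {x | f x < t})

theorem isOpen_inter_lt (hA : IsOpen A) (t : ℝ) : IsOpen (A ∩ {x | f x < t}) :=
  hA.inter (isOpen_lt f.continuous continuous_const)

theorem isOpen_inter_gt (hA : IsOpen A) (t : ℝ) : IsOpen (A ∩ {x | t < f x}) :=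
  hA.inter (isOpen_lt continuous_const f.continuous)

theorem lowerVolume_mono (hμA : μ A = 1) : Monotone (lowerVolume μ f A) := fun _ _ h =>
  measureReal_mono (inter_subset_inter_right _ fun _ hx => lt_of_lt_of_le hx h)
    (measure_ne_top_of_subset inter_subset_left (by simp [hμA]))

theorem lowerVolume_le_one (hμA : μ A = 1) (t : ℝ) : lowerVolume μ f A t ≤ 1 := by
  have : μ.real A = 1 := by simp [measureReal_def, hμA]
  rw [← this]
  exact measureReal_mono inter_subset_left (by simp [hμA])

theorem measure_inter_lt (hμA : μ A = 1) (t : ℝ) :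
    μ (A ∩ {x | f x < t}) = ENNReal.ofReal (lowerVolume μ f A t) := by
  rw [lowerVolume, ofReal_measureReal (measure_ne_top_of_subset inter_subset_left (by simp [hμA]))]

theorem measure_inter_ge (hμA : μ A = 1) (t : ℝ) :
    μ (A ∩ {x | t ≤ f x}) = ENNReal.ofReal (1 - lowerVolume μ f A t) := by
  have hm : MeasurableSet {x | f x < t} := (isOpen_lt f.continuous continuous_const).measurableSet
  have := measure_inter_add_sdiff (μ := μ) A hm
  rw [hμA, measure_inter_lt hμA] at this
  have e : A \ {x | f x < t} = A ∩ {x | t ≤ f x} := by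
    ext x; simp
  rw [e] at this
  rw [ENNReal.ofReal_sub _ (show 0 ≤ lowerVolume μ f A t from measureReal_nonneg), ENNReal.ofReal_one, ← this,
    ENNReal.add_sub_cancel_left ENNReal.ofReal_ne_top]

theorem measure_inter_gt (hf : f ≠ 0) (hμA : μ A = 1) (t : ℝ) :
    μ (A ∩ {x | t < f x}) = ENNReal.ofReal (1 - lowerVolume μ f A t) := by
  rw [← measure_inter_ge hμA]
  refine measure_congr ?_
  have : ∀ᵐ x ∂μ, f x ≠ t := by simpa [ae_iff] using measure_hyperplane μ hf t
  filter_upwards [this] with x hx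
  exact propext (and_congr_right fun _ => ⟨fun h => le_of_lt (α := ℝ) h,
    fun h => lt_of_le_of_ne (α := ℝ) h hx.symm⟩)

theorem continuous_lowerVolume (hf : f ≠ 0) (hA : IsOpen A) (hμA : μ A = 1) :
    Continuous (lowerVolume μ f A) := by
  refine continuous_iff_continuousAt.2 fun t => ?_
  refine (ENNReal.tendsto_toReal (measure_ne_top_of_subset inter_subset_left (by simp [hμA]))).comp
    (tendsto_measure_of_ae_tendsto_indicator (𝓝 t) (isOpen_inter_lt hA t).measurableSet
      (fun i => (isOpen_inter_lt hA i).measurableSet) hA.measurableSet (by simp [hμA])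
      (.of_forall fun i => inter_subset_left) ?_)
  have : ∀ᵐ x ∂μ, f x ≠ t := by simpa [ae_iff] using measure_hyperplane μ hf t
  filter_upwards [this] with x hx
  rcases hx.lt_or_gt with h | h
  · filter_upwards [lt_mem_nhds h] with i hi
    simp [hi, h]
  · filter_upwards [gt_mem_nhds h] with i hi
    simp [hi.not_gt, h.not_gt]

/-- The image `f '' A` is an interval with points below `u` and above `t`, so `A` meets the slab `t
< f < u` in a nonempty open set, which has positive measure. -/
theorem lowerVolume_lt (hf : f ≠ 0) (hA : IsOpen A) (hAc : Convex ℝ A) (hμA : μ A = 1) {t u : ℝ}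
    (htu : t < u) (ht : lowerVolume μ f A t < 1) (hu : 0 < lowerVolume μ f A u) :
    lowerVolume μ f A t < lowerVolume μ f A u := by
  obtain ⟨x, hxA, hx⟩ : (A ∩ {x | f x < u}).Nonempty := by
    by_contra h
    simp [lowerVolume, not_nonempty_iff_eq_empty.1 h] at hu
  obtain ⟨y, hyA, hy⟩ : (A ∩ {x | t < f x}).Nonempty := by
    by_contra h
    have := measure_inter_gt hf hμA t
    rw [not_nonempty_iff_eq_empty.1 h, measure_empty, eq_comm, ENNReal.ofReal_eq_zero] at this
    linarith
  have hx : f x < u := hx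
  have hy : t < f y := hy
  obtain ⟨z, hzA, hz1, hz2⟩ : ∃ z ∈ A, t < f z ∧ f z < u := by
    rcases lt_or_ge t (f x) with h | h
    · exact ⟨x, hxA, h, hx⟩
    rcases lt_or_ge (f y) u with h' | h'
    · exact ⟨y, hyA, hy, h'⟩
    have hc : Convex ℝ (f '' A) := hAc.linear_image (f : E →ₗ[ℝ] ℝ)
    obtain ⟨z, hz, hfz⟩ := hc.ordConnected.out (mem_image_of_mem f hxA) (mem_image_of_mem f hyA)
      (show (t + u) / 2 ∈ Icc (f x) (f y) from ⟨by linarith, by linarith⟩)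
    exact ⟨z, hz, by linarith, by linarith⟩
  have hfin : ∀ D ⊆ A, μ D ≠ ⊤ := fun D hD => measure_ne_top_of_subset hD (by simp [hμA])
  set S := (A ∩ {x | f x < u}) ∩ {x | t < f x} with hS
  have hSo : IsOpen S := isOpen_inter_gt (isOpen_inter_lt hA u) t
  have hSpos : 0 < μ.real S :=
    ENNReal.toReal_pos (hSo.measure_pos μ ⟨z, ⟨hzA, hz2⟩, hz1⟩).ne'
      (hfin _ fun x hx => hx.1.1)
  have hd : Disjoint (A ∩ {x | f x < t}) S := Set.disjoint_left.2 fun x h1 h2 =>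
    lt_asymm (show f x < t from h1.2) h2.2
  calc lowerVolume μ f A t < μ.real (A ∩ {x | f x < t}) + μ.real S := by
        rw [lowerVolume]; linarith
    _ = μ.real ((A ∩ {x | f x < t}) ∪ S) :=
        (measureReal_union hd hSo.measurableSet (hfin _ inter_subset_left)
          (hfin _ fun x hx => hx.1.1)).symm
    _ ≤ _ := measureReal_mono (union_subset
        (inter_subset_inter_right _ fun x hx => lt_trans hx htu) inter_subset_left)
        (hfin _ inter_subset_left)

/-- Existence and continuity of the quantile function of an open convex set in a given direction,
parametrized by the `N`-th root of the volume. -/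
theorem exists_quantile (hf : f ≠ 0) (hA : IsOpen A) (hAc : Convex ℝ A) (hAb : IsBounded A)
    (hμA : μ A = 1) {N : ℕ} (hN : N ≠ 0) :
    ∃ ψ : ℝ → ℝ, ContinuousOn ψ (Ioo 0 1) ∧
      (∀ a ∈ Ioo (0 : ℝ) 1, lowerVolume μ f A (ψ a) = a ^ N) ∧
      ∀ a ∈ Ioo (0 : ℝ) 1, ∀ t, a ^ N ≤ lowerVolume μ f A t ↔ ψ a ≤ t := by
  have hcont := continuous_lowerVolume hf hA hμA
  have hmono := lowerVolume_mono (f := f) hμA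
  have hpow : ∀ a ∈ Ioo (0 : ℝ) 1, 0 < a ^ N ∧ a ^ N < 1 := fun a ha =>
    ⟨pow_pos ha.1 N, pow_lt_one₀ ha.1.le ha.2 hN⟩
  obtain ⟨M, hM⟩ := (hAb.image f).exists_norm_le
  have hM' : ∀ x ∈ A, |f x| ≤ M := fun x hx => hM _ (mem_image_of_mem f hx)
  have hlow : lowerVolume μ f A (-M) = 0 := by
    have : A ∩ {x | f x < -M} = ∅ := eq_empty_of_forall_notMem fun x hx => by
      have h1 := (abs_le.1 (hM' x hx.1)).1
      have h2 : f x < -M := hx.2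
      linarith
    rw [lowerVolume, this, measureReal_empty]
  have hup : lowerVolume μ f A (M + 1) = 1 := by
    have : A ∩ {x | f x < M + 1} = A := inter_eq_left.2 fun x hx => by
      have h1 := (abs_le.1 (hM' x hx)).2
      show f x < M + 1
      linarith
    rw [lowerVolume, this, measureReal_def, hμA, ENNReal.toReal_one]
  have hMM : -M ≤ M + 1 := by
    by_contra h
    have := hmono (not_le.1 h).le
    linarith
  have hex : ∀ a : ℝ, ∃ t, a ∈ Ioo (0 : ℝ) 1 → lowerVolume μ f A t = a ^ N := fun a => by
    by_cases ha : a ∈ Ioo (0 : ℝ) 1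
    · obtain ⟨t, -, ht⟩ := intermediate_value_Icc hMM hcont.continuousOn
        (show a ^ N ∈ Icc _ _ by rw [hlow, hup]; exact ⟨(hpow a ha).1.le, (hpow a ha).2.le⟩)
      exact ⟨t, fun _ => ht⟩
    · exact ⟨0, fun h => absurd h ha⟩
  choose ψ hψ using hex
  have hiff : ∀ a ∈ Ioo (0 : ℝ) 1, ∀ t, a ^ N ≤ lowerVolume μ f A t ↔ ψ a ≤ t := fun a ha t => by
    rw [← hψ a ha]
    refine ⟨fun h => ?_, fun h => hmono h⟩
    by_contra hlt
    have hlt := not_le.1 hlt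
    refine (lowerVolume_lt hf hA hAc hμA hlt ?_ ?_).not_ge h
    · exact (hmono hlt.le).trans_lt (by rw [hψ a ha]; exact (hpow a ha).2)
    · rw [hψ a ha]; exact (hpow a ha).1
  refine ⟨ψ, ?_, hψ, hiff⟩
  have hψm : MonotoneOn ψ (Ioo 0 1) := fun a ha b hb hab => by
    rw [← hiff a ha, hψ b hb]
    exact pow_le_pow_left₀ ha.1.le hab N
  -- A monotone function whose image fills a neighbourhood of `ψ a` has no jump at `a`: every nearby
  -- level `t` is the value of `ψ` at the `N`-th root of its lower volume.
  refine fun a ha => (continuousAt_of_monotoneOn_of_image_mem_nhds hψm (isOpen_Ioo.mem_nhds ha)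
    ?_).continuousWithinAt
  have hopen : IsOpen {t | lowerVolume μ f A t ∈ Ioo (0 : ℝ) 1} := isOpen_Ioo.preimage hcont
  refine mem_of_superset (hopen.mem_nhds (show lowerVolume μ f A (ψ a) ∈ Ioo (0 : ℝ) 1 by
    rw [hψ a ha]; exact hpow a ha)) fun t ht => ?_
  have ht : lowerVolume μ f A t ∈ Ioo (0 : ℝ) 1 := ht
  have hroot : ((lowerVolume μ f A t) ^ (N⁻¹ : ℝ)) ^ N = lowerVolume μ f A t :=
    Real.rpow_inv_natCast_pow ht.1.le hN
  have hb : (lowerVolume μ f A t) ^ (N⁻¹ : ℝ) ∈ Ioo (0 : ℝ) 1 :=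
    ⟨Real.rpow_pos_of_pos ht.1 _, Real.rpow_lt_one ht.1.le ht.2 (by positivity)⟩
  refine ⟨_, hb, ?_⟩
  set b := (lowerVolume μ f A t) ^ (N⁻¹ : ℝ)
  refine le_antisymm ((hiff b hb t).1 hroot.le) (le_of_not_gt fun h => ?_)
  have := lowerVolume_lt hf hA hAc hμA h (by rw [hψ b hb, hroot]; exact ht.2) ht.1
  rw [hψ b hb, hroot] at this
  exact lt_irrefl _ this

/-- In the equality case of the Brunn–Minkowski inequality for convex sets of volume one, the
volumes cut off by parallel hyperplanes agree up to a shift. -/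
theorem exists_lowerVolume_eq (hf : f ≠ 0) (hA : IsOpen A) (hB : IsOpen B) (hAc : Convex ℝ A)
    (hBc : Convex ℝ B) (hAb : IsBounded A) (hBb : IsBounded B) (hμA : μ A = 1) (hμB : μ B = 1)
    {s : ℝ} (hs₀ : 0 < s) (hs₁ : s < 1) (hμC : μ ((1 - s) • A + s • B) = 1) :
    ∃ k, ∀ t, lowerVolume μ f A t = lowerVolume μ f B (t + k) := by
  have hs' : 0 < 1 - s := by linarith
  set C := (1 - s) • A + s • B with hC
  have hCo : IsOpen C := (hA.smul₀ hs'.ne').add_right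
  have hCc : Convex ℝ C := (hAc.smul _).add (hBc.smul _)
  set N := Module.finrank ℝ E with hNdef
  have hN : N ≠ 0 := fun h => hf <| by
    have := Module.finrank_zero_iff.1 h
    ext x
    rw [Subsingleton.elim x 0]; simp
  have hpow : ∀ a ∈ Ioo (0 : ℝ) 1, 0 < a ^ N ∧ a ^ N < 1 := fun a ha =>
    ⟨pow_pos ha.1 N, pow_lt_one₀ ha.1.le ha.2 hN⟩
  obtain ⟨φ, hφc, hφ, hφ'⟩ := exists_quantile hf hA hAc hAb hμA hN
  obtain ⟨ψ, hψc, hψ, hψ'⟩ := exists_quantile hf hB hBc hBb hμB hN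
  have hlow : ∀ a ∈ Ioo (0 : ℝ) 1, ∀ b ∈ Ioo (0 : ℝ) 1,
      ((1 - s) * a + s * b) ^ N ≤ lowerVolume μ f C ((1 - s) * φ a + s * ψ b) := by
    intro a ha b hb
    have h1 := brunnMinkowski_convexComb μ (isOpen_inter_lt (f := f) hA (φ a))
      (isOpen_inter_lt (f := f) hB (ψ b)) (hAb.subset inter_subset_left)
      (hBb.subset inter_subset_left) ha.1 hb.1 (by rw [measure_inter_lt hμA, hφ a ha])
      (by rw [measure_inter_lt hμB, hψ b hb]) hs₀ hs₁
    have h2 : (1 - s) • (A ∩ {x | f x < φ a}) + s • (B ∩ {x | f x < ψ b}) ⊆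
        C ∩ {x | f x < (1 - s) * φ a + s * ψ b} := by
      rintro _ ⟨_, ⟨x, hx, rfl⟩, _, ⟨y, hy, rfl⟩, rfl⟩
      refine ⟨⟨_, ⟨x, hx.1, rfl⟩, _, ⟨y, hy.1, rfl⟩, rfl⟩, ?_⟩
      have hx2 : f x < φ a := hx.2
      have hy2 : f y < ψ b := hy.2
      simp only [mem_ofPred_eq, map_add, map_smul, smul_eq_mul]
      gcongr
    have h3 := h1.trans (measure_mono h2)
    rw [measure_inter_lt hμC] at h3
    exact (ENNReal.ofReal_le_ofReal_iff measureReal_nonneg).1 h3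
  -- Brunn–Minkowski for the upper parts, both of volume `1 - c ^ N`; since `C` has total volume
  -- one, this bounds its lower part from above.
  have hupp : ∀ c ∈ Ioo (0 : ℝ) 1, lowerVolume μ f C ((1 - s) * φ c + s * ψ c) ≤ c ^ N := by
    intro c hc
    have hd0 : 0 < 1 - c ^ N := by linarith [(hpow c hc).2]
    set d := (1 - c ^ N) ^ (N⁻¹ : ℝ)
    have hd : d ^ N = 1 - c ^ N := Real.rpow_inv_natCast_pow hd0.le hN
    have hd' : 0 < d := Real.rpow_pos_of_pos hd0 _
    have h1 := brunnMinkowski_convexComb μ (isOpen_inter_gt (f := f) hA (φ c))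
      (isOpen_inter_gt (f := f) hB (ψ c)) (hAb.subset inter_subset_left)
      (hBb.subset inter_subset_left) hd' hd' (by rw [measure_inter_gt hf hμA, hφ c hc, hd])
      (by rw [measure_inter_gt hf hμB, hψ c hc, hd]) hs₀ hs₁
    have h2 : (1 - s) • (A ∩ {x | φ c < f x}) + s • (B ∩ {x | ψ c < f x}) ⊆
        C ∩ {x | (1 - s) * φ c + s * ψ c < f x} := by
      rintro _ ⟨_, ⟨x, hx, rfl⟩, _, ⟨y, hy, rfl⟩, rfl⟩
      refine ⟨⟨_, ⟨x, hx.1, rfl⟩, _, ⟨y, hy.1, rfl⟩, rfl⟩, ?_⟩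
      have hx2 : φ c < f x := hx.2
      have hy2 : ψ c < f y := hy.2
      simp only [mem_ofPred_eq, map_add, map_smul, smul_eq_mul]
      gcongr
    have h3 := h1.trans (measure_mono h2)
    have h4 := lowerVolume_le_one (f := f) hμC ((1 - s) * φ c + s * ψ c)
    rw [measure_inter_gt hf hμC, show (1 - s) * d + s * d = d by ring, ← hNdef, hd,
      ENNReal.ofReal_le_ofReal_iff (by linarith)] at h3
    linarith
  -- For `c = (1 - s) * a + s * b`, both bounds compare with `c ^ N`, and strict monotonicity of the
  -- lower volume of `C` orders the two levels. Hence the quantile functions differ by a constant.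
  obtain ⟨k, hk⟩ := exists_eq_add_const_of_convexComb_le hs₀ hs₁ hφc hψc fun a ha b hb => by
    have hc : (1 - s) * a + s * b ∈ Ioo (0 : ℝ) 1 := by
      have := convex_Ioo (0 : ℝ) 1 ha hb hs'.le hs₀.le (by ring)
      simpa using this
    by_contra hlt
    have hlt := not_le.1 hlt
    have h1 := hlow a ha b hb
    have h2 := hupp _ hc
    have h3 := lowerVolume_mono (f := f) hμC hlt.le
    have := lowerVolume_lt hf hCo hCc hμC hlt
      (h3.trans_lt (h2.trans_lt (hpow _ hc).2)) ((hpow _ hc).1.trans_le (h1.trans h3))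
    linarith
  refine ⟨k, fun t => ?_⟩
  have hiff : ∀ a ∈ Ioo (0 : ℝ) 1,
      (a ^ N ≤ lowerVolume μ f A t ↔ a ^ N ≤ lowerVolume μ f B (t + k)) := fun a ha => by
    rw [hφ' a ha, hψ' a ha, hk a ha, add_le_add_iff_right]
  have hbetween : ∀ {p q : ℝ}, 0 ≤ p → q ≤ 1 → p < q → ∃ a ∈ Ioo (0 : ℝ) 1, p < a ^ N ∧ a ^ N ≤ q :=
    fun {p q} hp hq hpq => by
      have hm0 : 0 < (p + q) / 2 := by linarith
      have hm1 : (p + q) / 2 < 1 := by linarith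
      refine ⟨((p + q) / 2) ^ (N⁻¹ : ℝ), ⟨Real.rpow_pos_of_pos hm0 _,
        Real.rpow_lt_one hm0.le hm1 (by positivity)⟩, ?_⟩
      rw [Real.rpow_inv_natCast_pow hm0.le hN]
      constructor <;> linarith
  rcases lt_trichotomy (lowerVolume μ f A t) (lowerVolume μ f B (t + k)) with h | h | h
  · obtain ⟨a, ha, h1, h2⟩ := hbetween measureReal_nonneg (lowerVolume_le_one hμB _) h
    exact absurd ((hiff a ha).2 h2) h1.not_ge
  · exact h
  · obtain ⟨a, ha, h1, h2⟩ := hbetween measureReal_nonneg (lowerVolume_le_one hμA _) h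
    exact absurd ((hiff a ha).1 h2) h1.not_ge

theorem integrableOn_id_of_isBounded (μ : Measure E) [μ.IsAddHaarMeasure] (hA : IsBounded A) :
    IntegrableOn (fun x => x) A μ := by
  have : ProperSpace E := FiniteDimensional.proper_real E
  exact (continuous_id.continuousOn.integrableOn_compact hA.isCompact_closure).mono_set
    subset_closure

/-- The shift between the volumes cut off by parallel hyperplanes is read off the barycenters. -/
theorem eq_of_lowerVolume_eq (hAb : IsBounded A) (hBb : IsBounded B)
    (hμA : μ A = 1) (hμB : μ B = 1) {k : ℝ}
    (h : ∀ t, lowerVolume μ f A t = lowerVolume μ f B (t + k)) :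
    k = f ((∫ x in B, x ∂μ) - ∫ x in A, x ∂μ) := by
  have hmA : Measurable fun x => f x + k := f.measurable.add_const k
  have : IsFiniteMeasure (μ.restrict A) := ⟨by simp [hμA]⟩
  have : IsFiniteMeasure ((μ.restrict A).map fun x => f x + k) := Measure.isFiniteMeasure_map _ _
  -- The two image measures on the line agree on half-lines, hence coincide; comparing their means
  -- gives `k`.
  have hmap : (μ.restrict A).map (fun x => f x + k) = (μ.restrict B).map f := by
    refine Measure.ext_of_Ici _ _ fun t => ?_
    rw [Measure.map_apply hmA measurableSet_Ici, Measure.map_apply f.measurable measurableSet_Ici,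
      Measure.restrict_apply (hmA measurableSet_Ici),
      Measure.restrict_apply (f.measurable measurableSet_Ici), inter_comm, inter_comm _ B]
    have h1 := measure_inter_ge (f := f) hμA (t - k)
    have h2 := measure_inter_ge (f := f) hμB t
    rw [h, sub_add_cancel, ← h2] at h1
    rw [show f ⁻¹' Ici t = {x | t ≤ f x} from rfl, ← h1]
    congr 2
    ext x
    simp
  have h1 : ∫ y, y ∂((μ.restrict A).map fun x => f x + k) = ∫ x in A, (f x + k) ∂μ :=
    integral_map hmA.aemeasurable aestronglyMeasurable_id
  have h2 : ∫ y, y ∂((μ.restrict B).map f) = ∫ x in B, f x ∂μ :=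
    integral_map f.measurable.aemeasurable aestronglyMeasurable_id
  have hiA := integrableOn_id_of_isBounded μ hAb
  rw [hmap, h2, f.integral_comp_comm (integrableOn_id_of_isBounded μ hBb),
    integral_add (f.integrable_comp hiA) (integrable_const _), f.integral_comp_comm hiA] at h1
  have h3 : μ.real A = 1 := by simp [measureReal_def, hμA]
  simp [h3] at h1
  rw [map_sub, h1]
  ring

/-- If `x + x₀ ∉ B`, a functional separates it from `B`, and equality of profiles leaves `A` no
volume above level `f x`. But `A` is open and `f` is an open map, so `A` has points strictly above
that level, and they form an open set of positive measure. -/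
theorem add_mem_of_lowerVolume_eq (hA : IsOpen A) (hB : IsOpen B) (hBc : Convex ℝ B)
    (hμA : μ A = 1) (hμB : μ B = 1) {x₀ : E}
    (h : ∀ f : E →L[ℝ] ℝ, f ≠ 0 → ∀ t, lowerVolume μ f A t = lowerVolume μ f B (t + f x₀))
    {x : E} (hx : x ∈ A) : x + x₀ ∈ B := by
  by_contra hn
  obtain ⟨f, hf⟩ := geometric_hahn_banach_open_point hBc hB hn
  have hBne : B.Nonempty := by
    by_contra h; simp [not_nonempty_iff_eq_empty.1 h] at hμB
  have hf0 : f ≠ 0 := by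
    rintro rfl
    obtain ⟨b, hb⟩ := hBne
    simpa using hf b hb
  have h1 : lowerVolume μ f B (f x + f x₀) = 1 := by
    have : B ∩ {y | f y < f x + f x₀} = B := inter_eq_left.2 fun y hy => by
      simpa using hf y hy
    rw [lowerVolume, this, measureReal_def, hμB, ENNReal.toReal_one]
  rw [← h f hf0] at h1
  have h2 := measure_inter_gt hf0 hμA (f x)
  rw [h1, sub_self, ENNReal.ofReal_zero, (isOpen_inter_gt hA (f x)).measure_eq_zero_iff μ] at h2
  have h3 : f '' A ∈ 𝓝 (f x) :=
    (f.isOpenMap_of_ne_zero hf0 A hA).mem_nhds (mem_image_of_mem f hx)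
  obtain ⟨ε, hε, hsub⟩ := Metric.mem_nhds_iff.1 h3
  obtain ⟨y, hy, hfy⟩ := hsub (show f x + ε / 2 ∈ Metric.ball (f x) ε by
    simp [abs_of_pos hε]; linarith)
  have : y ∈ A ∩ {y | f x < f y} := ⟨hy, by show f x < f y; linarith⟩
  rw [h2] at this
  exact this

/-- The equality case of the Brunn–Minkowski inequality for open convex sets of volume one. -/
theorem eq_image_add_of_volume_eq_one (hA : IsOpen A) (hB : IsOpen B) (hAc : Convex ℝ A)
    (hBc : Convex ℝ B) (hAb : IsBounded A) (hBb : IsBounded B) (hμA : μ A = 1) (hμB : μ B = 1)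
    {s : ℝ} (hs₀ : 0 < s) (hs₁ : s < 1) (hμC : μ ((1 - s) • A + s • B) = 1) :
    ∃ x₀, B = (fun x => x + x₀) '' A := by
  -- The difference of barycenters does not depend on `f`; this makes the shifts in all directions
  -- come from one vector.
  set x₀ := (∫ x in B, x ∂μ) - ∫ x in A, x ∂μ
  have h : ∀ f : E →L[ℝ] ℝ, f ≠ 0 → ∀ t, lowerVolume μ f A t = lowerVolume μ f B (t + f x₀) := by
    intro f hf
    obtain ⟨k, hk⟩ := exists_lowerVolume_eq hf hA hB hAc hBc hAb hBb hμA hμB hs₀ hs₁ hμC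
    rwa [eq_of_lowerVolume_eq hAb hBb hμA hμB hk] at hk
  refine ⟨x₀, Subset.antisymm (fun y hy => ?_) ?_⟩
  · refine ⟨y + -x₀, ?_, by simp⟩
    refine add_mem_of_lowerVolume_eq hB hA hAc hμB hμA (fun f hf t => ?_) hy
    rw [h f hf]
    simp
  · rintro _ ⟨x, hx, rfl⟩
    exact add_mem_of_lowerVolume_eq hA hB hBc hμA hμB h hx

end BrunnMinkowskiEquality

/-! ### The equality case for arbitrary volumes. -/

section EqualityCase

open Set Bornology
open scoped Pointwise

variable {E : Type*} [NormedAddCommGroup E] [NormedSpace ℝ E] [MeasurableSpace E] [BorelSpace E]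
  [FiniteDimensional ℝ E]

theorem exists_measure_eq_ofReal_pow (μ : Measure E) [μ.IsAddHaarMeasure] {N : ℕ} (hN : N ≠ 0)
    {A : Set E} (hA : IsOpen A) (hAb : IsBounded A) (hAne : A.Nonempty) :
    ∃ a : ℝ, 0 < a ∧ μ A = ENNReal.ofReal (a ^ N) := by
  have : ProperSpace E := FiniteDimensional.proper_real E
  have hfin := hAb.measure_lt_top (μ := μ).ne
  have hpos : 0 < (μ A).toReal := ENNReal.toReal_pos (hA.measure_pos μ hAne).ne' hfin
  refine ⟨(μ A).toReal ^ (N⁻¹ : ℝ), Real.rpow_pos_of_pos hpos _, ?_⟩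
  rw [Real.rpow_inv_natCast_pow hpos.le hN, ENNReal.ofReal_toReal hfin]

theorem image_smul_add_const (c : ℝ) (x₀ : E) (A : Set E) :
    (fun a => c • a + x₀) '' A = c • A + {x₀} := by
  rw [add_singleton, ← image_smul, image_image]

theorem measure_add_singleton (μ : Measure E) [μ.IsAddHaarMeasure] (A : Set E) (x : E) :
    μ (A + {x}) = μ A := by
  rw [add_singleton, image_add_right, measure_preimage_add_right]

/-- The equality case of the Brunn–Minkowski inequality for bounded open convex sets. -/
theorem brunnMinkowski_eq_iff (μ : Measure E) [μ.IsAddHaarMeasure]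
    (hN : Module.finrank ℝ E ≠ 0) {A B : Set E} (hA : IsOpen A) (hB : IsOpen B)
    (hAc : Convex ℝ A) (hBc : Convex ℝ B) (hAb : IsBounded A) (hBb : IsBounded B) {a b s : ℝ}
    (ha : 0 < a) (hb : 0 < b) (hμA : μ A = ENNReal.ofReal (a ^ Module.finrank ℝ E))
    (hμB : μ B = ENNReal.ofReal (b ^ Module.finrank ℝ E)) (hs₀ : 0 < s) (hs₁ : s < 1) :
    μ ((1 - s) • A + s • B) = ENNReal.ofReal (((1 - s) * a + s * b) ^ Module.finrank ℝ E) ↔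
      ∃ (c : ℝ) (x₀ : E), 0 < c ∧ B = (fun a => c • a + x₀) '' A := by
  have hs' : 0 < 1 - s := by linarith
  constructor
  · intro h
    set θ := (1 - s) * a + s * b with hθ
    have hθ0 : 0 < θ := by positivity
    have hA1 : μ (a⁻¹ • A) = 1 := by
      rw [addHaar_smul_of_pos μ (inv_nonneg.2 ha.le) hμA, inv_mul_cancel₀ ha.ne']; simp
    have hB1 : μ (b⁻¹ • B) = 1 := by
      rw [addHaar_smul_of_pos μ (inv_nonneg.2 hb.le) hμB, inv_mul_cancel₀ hb.ne']; simp
    -- After normalization the weight `s` becomes `s * b / θ`, for which the combination is `θ⁻¹`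
    -- times the original sum.
    have hC1 : μ ((1 - s * b / θ) • a⁻¹ • A + (s * b / θ) • b⁻¹ • B) = 1 := by
      have e1 : (1 - s * b / θ) * a⁻¹ = θ⁻¹ * (1 - s) := by
        field_simp
        rw [hθ]; ring
      have e2 : s * b / θ * b⁻¹ = θ⁻¹ * s := by field_simp
      rw [smul_smul, smul_smul, e1, e2, mul_smul, mul_smul, ← smul_add,
        addHaar_smul_of_pos μ (inv_nonneg.2 hθ0.le) h, inv_mul_cancel₀ hθ0.ne']
      simp
    have ht1 : s * b / θ < 1 := by
      rw [div_lt_one hθ0, hθ]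
      nlinarith [mul_pos hs' ha]
    obtain ⟨x, hx⟩ := eq_image_add_of_volume_eq_one (hA.smul₀ (inv_ne_zero ha.ne'))
      (hB.smul₀ (inv_ne_zero hb.ne')) (hAc.smul _) (hBc.smul _) (hAb.smul₀ _) (hBb.smul₀ _)
      hA1 hB1 (by positivity) ht1 hC1
    refine ⟨b / a, b • x, by positivity, ?_⟩
    calc B = b • b⁻¹ • B := (smul_inv_smul₀ hb.ne' B).symm
      _ = (fun y => (b / a) • y + b • x) '' A := by
        rw [hx, ← image_smul, ← image_smul, image_image, image_image]
        refine image_congr' fun y => ?_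
        rw [smul_add, smul_smul, div_eq_mul_inv]
  · rintro ⟨c, x₀, hc, h⟩
    rw [image_smul_add_const] at h
    have hb' : b = c * a := by
      rw [h, measure_add_singleton, addHaar_smul_of_pos μ hc.le hμA,
        ENNReal.ofReal_eq_ofReal_iff (by positivity) (by positivity)] at hμB
      exact ((pow_left_inj₀ (by positivity) (by positivity) hN).1 hμB).symm
    -- Convexity of `A` merges the two dilates of `A` into one.
    have hZ : (1 - s) • A + s • B = ((1 - s) + s * c) • A + {s • x₀} := by
      rw [h, smul_add, smul_set_singleton, smul_smul, ← add_assoc,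
        hAc.add_smul hs'.le (by positivity)]
    rw [hZ, measure_add_singleton, addHaar_smul_of_pos μ (by positivity) hμA, hb']
    congr 2
    ring

end EqualityCase

/-! ### Translation back to the Finsler setting, and balls. -/

section Minkowski

open Set Bornology
open scoped Pointwise

variable {n : ℕ} {F : EuclideanSpace ℝ (Fin n) → ℝ} {m : Measure (EuclideanSpace ℝ (Fin n))}

/-- The Busemann–Hausdorff density is positive and finite because the unit ball of `F` is bounded,
open and nonempty. -/
theorem IsFinslerMeasure.isAddHaarMeasure (hF : IsMinkowskiNorm F) (hm : IsFinslerMeasure F m) :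
    m.IsAddHaarMeasure := by
  rcases hm with rfl | rfl
  · infer_instance
  · rw [busemannHausdorffMeasure, withDensity_const]
    exact Measure.IsAddHaarMeasure.smul _
      (ENNReal.div_ne_zero.2 ⟨(Metric.measure_ball_pos _ _ one_pos).ne',
        hF.isBounded_ball.measure_lt_top.ne⟩)
      (ENNReal.div_ne_top measure_ball_lt_top.ne
        (hF.isOpen_ball.measure_pos _ ⟨0, hF.zero_mem_ball⟩).ne')

theorem IsMinkowskiNorm.mem_forwardBall (hF : IsMinkowskiNorm F) {x z : EuclideanSpace ℝ (Fin n)}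
    {r : ℝ} : z ∈ forwardBall F x r ↔ F (z - x) < r := by
  rw [forwardBall, mem_ofPred_eq, hF.finslerDist_eq]

theorem IsMinkowskiNorm.mem_backwardBall (hF : IsMinkowskiNorm F)
    {x z : EuclideanSpace ℝ (Fin n)} {r : ℝ} : z ∈ backwardBall F x r ↔ F (x - z) < r := by
  rw [backwardBall, mem_ofPred_eq, hF.finslerDist_eq]

theorem IsMinkowskiNorm.map_inv_smul_lt_one_iff (hF : IsMinkowskiNorm F) {r : ℝ} (hr : 0 < r)
    (v : EuclideanSpace ℝ (Fin n)) : F (r⁻¹ • v) < 1 ↔ F v < r := by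
  rw [hF.homogeneous _ _ (inv_nonneg.2 hr.le), inv_mul_lt_iff₀ hr, mul_one]

theorem IsMinkowskiNorm.forwardBall_eq (hF : IsMinkowskiNorm F) (x : EuclideanSpace ℝ (Fin n))
    {r : ℝ} (hr : 0 < r) : forwardBall F x r = r • {v | F v < 1} + {x} := by
  ext z
  rw [hF.mem_forwardBall, add_singleton, image_add_right, mem_preimage,
    mem_smul_set_iff_inv_smul_mem₀ hr.ne', mem_ofPred_eq, hF.map_inv_smul_lt_one_iff hr,
    sub_eq_add_neg]

theorem IsMinkowskiNorm.backwardBall_eq (hF : IsMinkowskiNorm F) (x : EuclideanSpace ℝ (Fin n))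
    {r : ℝ} (hr : 0 < r) : backwardBall F x r = (-r) • {v | F v < 1} + {x} := by
  ext z
  rw [hF.mem_backwardBall, add_singleton, image_add_right, mem_preimage,
    mem_smul_set_iff_inv_smul_mem₀ (neg_ne_zero.2 hr.ne'), mem_ofPred_eq, inv_neg, neg_smul,
    ← smul_neg, hF.map_inv_smul_lt_one_iff hr, neg_add_rev, neg_neg, sub_eq_add_neg]

theorem ENNReal.ofReal_pow_rpow_one_div {n : ℕ} (hn : n ≠ 0) {a : ℝ} (ha : 0 ≤ a) :
    ENNReal.ofReal (a ^ n) ^ (1 / (n : ℝ)) = ENNReal.ofReal a := by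
  rw [ENNReal.ofReal_pow ha, ← ENNReal.rpow_natCast, ← ENNReal.rpow_mul,
    mul_one_div_cancel (by exact_mod_cast hn), ENNReal.rpow_one]

theorem bmRight_eq {s : ℝ} (hs₀ : 0 < s) (hs₁ : s < 1) (hn : n ≠ 0)
    {A B : Set (EuclideanSpace ℝ (Fin n))} {a b : ℝ} (ha : 0 < a) (hb : 0 < b)
    (hA : m A = ENNReal.ofReal (a ^ n)) (hB : m B = ENNReal.ofReal (b ^ n)) :
    bmRight m s A B = ENNReal.ofReal (((1 - s) * a + s * b) ^ n) ^ (1 / (n : ℝ)) := by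
  have hs' : 0 < 1 - s := by linarith
  rw [bmRight, hA, hB, ENNReal.ofReal_pow_rpow_one_div hn ha.le,
    ENNReal.ofReal_pow_rpow_one_div hn hb.le, ENNReal.ofReal_pow_rpow_one_div hn (by positivity),
    ENNReal.ofReal_add (by positivity) (by positivity), ENNReal.ofReal_mul hs'.le,
    ENNReal.ofReal_mul hs₀.le]

theorem bmRight_le_bmLeft (hn : n ≠ 0) (hF : IsMinkowskiNorm F) [m.IsAddHaarMeasure] {s : ℝ}
    (hs₀ : 0 < s) (hs₁ : s < 1) {A B : Set (EuclideanSpace ℝ (Fin n))} (hAne : A.Nonempty)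
    (hBne : B.Nonempty) (hA : IsOpen A) (hB : IsOpen B) (hAb : IsBounded A) (hBb : IsBounded B) :
    bmRight m s A B ≤ bmLeft F m s A B := by
  obtain ⟨a, ha, hμA⟩ := exists_measure_eq_ofReal_pow m hn hA hAb hAne
  obtain ⟨b, hb, hμB⟩ := exists_measure_eq_ofReal_pow m hn hB hBb hBne
  rw [bmRight_eq hs₀ hs₁ hn ha hb hμA hμB, bmLeft, hF.interpolationSet_eq hs₀ hs₁]
  have := brunnMinkowski_convexComb m hA hB hAb hBb ha hb (by simpa using hμA)
    (by simpa using hμB) hs₀ hs₁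
  rw [finrank_euclideanSpace_fin] at this
  gcongr

theorem bmLeft_eq_bmRight_iff (hn : n ≠ 0) (hF : IsMinkowskiNorm F) [m.IsAddHaarMeasure] {s : ℝ}
    (hs₀ : 0 < s) (hs₁ : s < 1) {A B : Set (EuclideanSpace ℝ (Fin n))} (hAne : A.Nonempty)
    (hBne : B.Nonempty) (hA : IsOpen A) (hB : IsOpen B) (hAb : IsBounded A) (hBb : IsBounded B)
    (hAc : Convex ℝ A) (hBc : Convex ℝ B) :
    bmLeft F m s A B = bmRight m s A B ↔ AreHomothetic A B := by
  obtain ⟨a, ha, hμA⟩ := exists_measure_eq_ofReal_pow m hn hA hAb hAne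
  obtain ⟨b, hb, hμB⟩ := exists_measure_eq_ofReal_pow m hn hB hBb hBne
  have := brunnMinkowski_eq_iff m (by simpa using hn) hA hB hAc hBc hAb hBb ha hb
    (by simpa using hμA) (by simpa using hμB) hs₀ hs₁
  rw [finrank_euclideanSpace_fin] at this
  rw [bmRight_eq hs₀ hs₁ hn ha hb hμA hμB, bmLeft, hF.interpolationSet_eq hs₀ hs₁,
    (ENNReal.rpow_left_injective (one_div_ne_zero (by exact_mod_cast hn))).eq_iff, this]
  rfl

/-- A forward ball is homothetic to a backward ball iff the corresponding balls of equal radius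
are translates of each other. -/
theorem IsMinkowskiNorm.areHomothetic_forwardBall_backwardBall_iff (hn : n ≠ 0)
    (hF : IsMinkowskiNorm F) (x y : EuclideanSpace ℝ (Fin n)) {r R : ℝ} (hr : 0 < r)
    (hR : 0 < R) :
    AreHomothetic (forwardBall F x r) (backwardBall F y R) ↔
      ∃ x₀, backwardBall F (y - x₀) R = forwardBall F ((R / r) • x) R := by
  set K := {v | F v < 1} with hK
  have himage : ∀ c > 0, ∀ x₀, (fun a => c • a + x₀) '' forwardBall F x r =
      (c * r) • K + {c • x + x₀} := fun c hc x₀ => by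
    rw [image_smul_add_const, hF.forwardBall_eq x hr, smul_add, smul_smul, smul_set_singleton,
      add_assoc, singleton_add_singleton]
  have hback : ∀ x₀, backwardBall F (y - x₀) R = backwardBall F y R + {-x₀} := fun x₀ => by
    rw [hF.backwardBall_eq _ hR, hF.backwardBall_eq _ hR, add_assoc, singleton_add_singleton,
      sub_eq_add_neg]
  have hcR : R / r * r = R := div_mul_cancel₀ R hr.ne'
  constructor
  · rintro ⟨c, x₀, hc, h⟩
    rw [himage c hc] at h
    -- Reflection preserves volume, so comparing the volumes `(c * r) ^ n` and `R ^ n`, in units of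
    -- the volume of `K`, fixes the ratio.
    have hc' : c = R / r := by
      have hvol := congrArg volume h
      obtain ⟨k, hk, hKk⟩ := exists_measure_eq_ofReal_pow
        (volume : Measure (EuclideanSpace ℝ (Fin n))) hn hF.isOpen_ball hF.isBounded_ball
        ⟨0, hF.zero_mem_ball⟩
      rw [hF.backwardBall_eq y hR, measure_add_singleton, measure_add_singleton,
        Measure.addHaar_smul, Measure.addHaar_smul, finrank_euclideanSpace_fin, ← hK, hKk,
        ← ENNReal.ofReal_mul (abs_nonneg _), ← ENNReal.ofReal_mul (abs_nonneg _),
        ENNReal.ofReal_eq_ofReal_iff (by positivity) (by positivity), abs_pow, abs_pow, abs_neg,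
        abs_of_pos hR, abs_of_pos (mul_pos hc hr)] at hvol
      have := mul_right_cancel₀ (pow_pos hk n).ne' hvol
      have := (pow_left_inj₀ hR.le (by positivity) hn).1 this
      rw [this, mul_div_cancel_right₀ _ hr.ne']
    refine ⟨x₀, ?_⟩
    rw [hback, h, hc', hcR, hF.forwardBall_eq _ hR, add_assoc, singleton_add_singleton,
      add_neg_cancel_right]
  · rintro ⟨x₀, h⟩
    refine ⟨R / r, x₀, by positivity, ?_⟩
    rw [himage _ (by positivity), hcR, ← singleton_add_singleton, ← add_assoc,
      ← hF.forwardBall_eq _ hR, ← h, hback, add_assoc, singleton_add_singleton]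
    simp

end Minkowski

theorem corollary5p2 {n : ℕ} (hn : 1 ≤ n) (F : EuclideanSpace ℝ (Fin n) → ℝ)
    (hF : IsMinkowskiNorm F) (m : Measure (EuclideanSpace ℝ (Fin n)))
    (hm : IsFinslerMeasure F m) (s : ℝ) (hs₀ : 0 < s) (hs₁ : s < 1) :
    (∀ A B : Set (EuclideanSpace ℝ (Fin n)), A.Nonempty → B.Nonempty → IsOpen A → IsOpen B →
      Bornology.IsBounded A → Bornology.IsBounded B →
        bmRight m s A B ≤ bmLeft F m s A B ∧
        (Convex ℝ A → Convex ℝ B →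
          (bmLeft F m s A B = bmRight m s A B ↔ AreHomothetic A B))) ∧
    (∀ (x y : EuclideanSpace ℝ (Fin n)) (r R : ℝ), 0 < r → 0 < R →
      (bmLeft F m s (forwardBall F x r) (backwardBall F y R) =
          bmRight m s (forwardBall F x r) (backwardBall F y R) ↔
        ∃ x₀ : EuclideanSpace ℝ (Fin n),
          backwardBall F (y - x₀) R = forwardBall F ((R / r) • x) R)) := by
  have hn0 : n ≠ 0 := by omega
  have := hm.isAddHaarMeasure hF
  refine ⟨fun A B hAne hBne hA hB hAb hBb => ⟨bmRight_le_bmLeft hn0 hF hs₀ hs₁ hAne hBne hA hB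
    hAb hBb, fun hAc hBc => bmLeft_eq_bmRight_iff hn0 hF hs₀ hs₁ hAne hBne hA hB hAb hBb hAc hBc⟩,
    fun x y r R hr hR => ?_⟩
  rw [← hF.areHomothetic_forwardBall_backwardBall_iff hn0 x y hr hR]
  have hx : x ∈ forwardBall F x r := by
    rw [hF.mem_forwardBall, sub_self, hF.map_zero]; exact hr
  have hy : y ∈ backwardBall F y R := by
    rw [hF.mem_backwardBall, sub_self, hF.map_zero]; exact hR
  refine bmLeft_eq_bmRight_iff hn0 hF hs₀ hs₁ ⟨x, hx⟩ ⟨y, hy⟩ ?_ ?_ ?_ ?_ ?_ ?_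
  · rw [hF.forwardBall_eq x hr]
    exact (hF.isOpen_ball.smul₀ hr.ne').add_right
  · rw [hF.backwardBall_eq y hR]
    exact (hF.isOpen_ball.smul₀ (neg_ne_zero.2 hR.ne')).add_right
  · rw [hF.forwardBall_eq x hr]
    exact (hF.isBounded_ball.smul₀ _).add Bornology.isBounded_singleton
  · rw [hF.backwardBall_eq y hR]
    exact (hF.isBounded_ball.smul₀ _).add Bornology.isBounded_singleton
  · rw [hF.forwardBall_eq x hr]
    exact (hF.convex_ball.smul _).add (convex_singleton x)
  · rw [hF.backwardBall_eq y hR]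
    exact (hF.convex_ball.smul _).add (convex_singleton y)
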